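/- Let $n\ge 2$ and let $f,g\colon S^{n-1}\to\mathbb R$ be even, continuous, (strictly) positive functions on the unit sphere $S^{n-1}\subset\mathbb R^n$. Let $$Rf(\theta)=\int_{S^{n-1}\cap\theta^\perp} f(\xi)\,d\xi,\qquad \theta\in S^{n-1},$$ be the spherical Radon transform, where $\theta^\perp$ is the hyperplane through the origin orthogonal to $\theta$ and the integration is with respect to the $(n-2)$-dimensional surface measure on $S^{n-1}\cap\theta^\perp$ (counting measure if $n=2$), and for $p>0$ let $\|h\|_{L^p(S^{n-1})}=\left(\int_{S^{n-1}}|h(x)|^p\,dx\right)^{1/p}$, with respect to the surface measure on $S^{n-1}$. A tempered distribution on $\mathbb R^n$ is called positive definite if its Fourier transform is a positive distribution, that is, takes nonnegative values on nonnegative Schwartz functions. Suppose that $$Rf(\theta)\le Rg(\theta)\qquad\text{for all }\theta\in S^{n-1}.$$ (a) If $p>1$ and the locally integrable function $x\mapsto |x|_2^{-1}f^{p-1}\!\left(\frac{x}{|x|_2}\right)$ represents a positive definite distribution on $\mathbb R^n$, then $\|f\|_{L^p(S^{n-1})}\le\|g\|_{L^p(S^{n-1})}$. (b) If $0<p<1$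 and the locally integrable function $x\mapsto |x|_2^{-1}g^{p-1}\!\left(\frac{x}{|x|_2}\right)$ represents a positive definite distribution on $\mathbb R^n$, then $\|f\|_{L^p(S^{n-1})}\le\|g\|_{L^p(S^{n-1})}$. -/

import Mathlib

open MeasureTheory SchwartzMap FourierTransform Metric
open scoped ComplexOrder

noncomputable section

/-- Euclidean space `ℝⁿ`. -/
abbrev Euc (n : ℕ) : Type := EuclideanSpace ℝ (Fin n)

/-- The unit sphere `S^{n-1}` of `ℝⁿ`. -/
abbrev Sph (n : ℕ) : Type := sphere (0 : Euc n) 1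

/-- The surface measure on `S^{n-1}` (the polar-coordinates measure of Lebesgue measure, of total
mass `n * |B|`). -/
def surfaceMeasure (n : ℕ) : Measure (Sph n) := (volume : Measure (Euc n)).toSphere

/-- The hyperplane `θ^⊥` through the origin, orthogonal to `θ`. -/
abbrev perpHyperplane {n : ℕ} (θ : Sph n) : Submodule ℝ (Euc n) := (ℝ ∙ (θ : Euc n))ᗮ

/-- The great subsphere `S^{n-1} ∩ θ^⊥`, as the unit sphere of the Euclidean space `θ^⊥`. -/
abbrev SubSph {n : ℕ} (θ : Sph n) : Type := sphere (0 : perpHyperplane θ) 1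

/-- The inclusion `S^{n-1} ∩ θ^⊥ → S^{n-1}`. -/
def subSphIncl {n : ℕ} (θ : Sph n) (ξ : SubSph θ) : Sph n :=
  ⟨((ξ : perpHyperplane θ) : Euc n), by
    have h : ‖(ξ : perpHyperplane θ)‖ = 1 := norm_eq_of_mem_sphere ξ
    exact mem_sphere_zero_iff_norm.mpr h⟩

/-- Lebesgue measure of the Euclidean space `θ^⊥`: the Haar measure that gives the unit cube on an
orthonormal basis mass one. -/
def perpLebesgue {n : ℕ} (θ : Sph n) : Measure (perpHyperplane θ) :=
  (stdOrthonormalBasis ℝ (perpHyperplane θ)).toBasis.addHaar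

/-- The `(n-2)`-dimensional surface measure on `S^{n-1} ∩ θ^⊥`. -/
def subSurfaceMeasure {n : ℕ} (θ : Sph n) : Measure (SubSph θ) := (perpLebesgue θ).toSphere

/-- The spherical Radon transform `Rf(θ) = ∫_{S^{n-1} ∩ θ^⊥} f(ξ) dξ`. -/
def sphericalRadon {n : ℕ} (f : Sph n → ℝ) (θ : Sph n) : ℝ :=
  ∫ ξ : SubSph θ, f (subSphIncl θ ξ) ∂(subSurfaceMeasure θ)

/-- The radial projection `x ↦ x / |x|` of a nonzero vector to the sphere. -/
def radialProj {n : ℕ} (x : Euc n) (hx : x ≠ 0) : Sph n :=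
  ⟨‖x‖⁻¹ • x, by
    rw [mem_sphere_zero_iff_norm, norm_smul, norm_inv, norm_norm,
      inv_mul_cancel₀ (norm_ne_zero_iff.mpr hx)]⟩

open Classical in
/-- The function `x ↦ |x|⁻¹ h(x / |x|)` on `ℝⁿ \ {0}`, with the (irrelevant) value `0` at `0`. -/
def homogExt {n : ℕ} (h : Sph n → ℝ) (x : Euc n) : ℝ :=
  if hx : x ≠ 0 then ‖x‖⁻¹ * h (radialProj x hx) else 0

/-- The function `u` represents the tempered distribution `T`:
it is locally integrable and `⟨T, φ⟩ = ∫ u(x) φ(x) dx` for every Schwartz function `φ`. -/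
def Represents {n : ℕ} (u : Euc n → ℝ) (T : 𝓢'(Euc n, ℂ)) : Prop :=
  LocallyIntegrable u ∧
    ∀ φ : 𝓢(Euc n, ℂ),
      Integrable (fun x => (u x : ℂ) * φ x) ∧ T φ = ∫ x, (u x : ℂ) * φ x

/-- A tempered distribution is positive: `⟨T, φ⟩ ≥ 0` for every Schwartz function `φ ≥ 0`
(for complex numbers, `0 ≤ z` says that `z` is real and nonnegative). -/
def IsPositiveDistribution {n : ℕ} (T : 𝓢'(Euc n, ℂ)) : Prop :=
  ∀ φ : 𝓢(Euc n, ℂ), (∀ x, 0 ≤ φ x) → 0 ≤ T φ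

/-- A tempered distribution is positive definite if its Fourier transform is a positive
distribution. (Rescaling the frequency variable does not change positivity, so the normalization
of the Fourier transform does not matter.) -/
def IsPositiveDefiniteDistribution {n : ℕ} (T : 𝓢'(Euc n, ℂ)) : Prop :=
  IsPositiveDistribution (𝓕 T)

/-- The function `u` represents a positive definite distribution on `ℝⁿ`. -/
def RepresentsPositiveDefinite {n : ℕ} (u : Euc n → ℝ) : Prop :=
  ∃ T : 𝓢'(Euc n, ℂ), Represents u T ∧ IsPositiveDefiniteDistribution T

end

/-! ### Gaussians and dilations as Schwartz functions -/

section GaussianSchwartz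

variable {V : Type*} [NormedAddCommGroup V] [InnerProductSpace ℝ V]

/-! Everything rests on one duality statement, `integral_mul_nonneg_of_sphericalRadon_nonneg`: if
`q` is even with nonnegative Radon transform and `|x|⁻¹ h(x/|x|)` is positive definite, then `∫ h q
≥ 0`. With `q = g - f` and `h = f^(p-1)` or `h = g^(p-1)` it gives `∫ f h ≤ ∫ g h`, and Hölder's
inequality finishes both parts.

For the duality, extend `q` to `Q(x) = |x| exp(-2|x|²) q(x/|x|)`. In polar coordinates, the integral
of `Q` over `θ^⊥` is `Rq(θ)` times a constant `I > 0`, and the integral of `Q` against `u = |x|⁻¹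
h(x/|x|)` is `∫ h q` times the same `I`. By Stone–Weierstrass, `Q` is approximated by a combination
`ψ` of translated Gaussians, slightly from above. The even part of `ψ` is the Fourier transform of
an explicit `φ` whose integral over the ray through `θ` is half the integral of `ψ` over `θ^⊥`,
hence bounded below by a positive constant.

The Fourier transform `Λ` of `u` is a positive functional with `Λ(φ(r·)) = r⁻¹ Λφ`. The function `φ`
may change sign, but `∑_{k<N} ρ^k φ(ρ^k ·)` is, for `ρ` near `1`, essentially a Riemann sum for ray
integrals: it becomes nonnegative after adding two Gaussian terms whose total `Λ`-value does not
depend on `N`. Since `Λ` maps the sum to `N Λφ`, letting `N` grow gives `Λφ ≥ 0`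
(`re_nonneg_of_ray_integral_pos`). Thus `∫ u ψ ≥ 0`, and removing the approximation error gives `∫ u
Q ≥ 0`. -/

theorem one_add_pow_mul_exp_neg_mul_sq_le {b : ℝ} (hb : 0 < b) (m : ℕ) {r : ℝ} (hr : 0 ≤ r) :
    (1 + r) ^ m * Real.exp (-b * r ^ 2) ≤ (2 / b) ^ m * m.factorial * Real.exp b := by
  have h1 : (1 + r) ^ m ≤ (2 * (1 + r ^ 2)) ^ m := by
    gcongr
    nlinarith [sq_nonneg r, sq_nonneg (r - 1)]
  -- The bound `y^m / m! ≤ exp y` at `y = b (1 + r²)`; the extra `b` in the exponent is what leaves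
  -- `exp b` in the constant.
  have h2 := Real.pow_div_factorial_le_exp (b * (1 + r ^ 2)) (by positivity) m
  rw [div_le_iff₀ (by positivity)] at h2
  have h3 : Real.exp (b * (1 + r ^ 2)) * Real.exp (-b * r ^ 2) = Real.exp b := by
    rw [← Real.exp_add]; ring_nf
  calc (1 + r) ^ m * Real.exp (-b * r ^ 2)
      ≤ (2 * (1 + r ^ 2)) ^ m * Real.exp (-b * r ^ 2) := by gcongr
    _ = (2 / b) ^ m * (b * (1 + r ^ 2)) ^ m * Real.exp (-b * r ^ 2) := by
        rw [← mul_pow]; congr 2; field_simp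
    _ ≤ (2 / b) ^ m * (Real.exp (b * (1 + r ^ 2)) * m.factorial) * Real.exp (-b * r ^ 2) := by
        gcongr
    _ = (2 / b) ^ m * m.factorial * (Real.exp (b * (1 + r ^ 2)) * Real.exp (-b * r ^ 2)) := by ring
    _ = _ := by rw [h3]

theorem exists_decay_exp_neg_mul_sq {b : ℝ} (hb : 0 < b) (k n : ℕ) :
    ∃ C : ℝ, ∀ x : V, ‖x‖ ^ k *
      ‖iteratedFDeriv ℝ n (fun x : V => Real.exp (-b * ‖x‖ ^ 2)) x‖ ≤ C := by
  have hf : Function.HasTemperateGrowth (fun x : V => -b * ‖x‖ ^ 2) :=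
    (Function.HasTemperateGrowth.const (-b)).mul (Function.hasTemperateGrowth_norm_sq V)
  obtain ⟨l, C, hC0, hC⟩ := hf.norm_iteratedFDeriv_le_uniform n
  have key : ∀ x : V, ‖iteratedFDeriv ℝ n (fun x : V => Real.exp (-b * ‖x‖ ^ 2)) x‖ ≤
      n.factorial * Real.exp (-b * ‖x‖ ^ 2) * ((C + 1) * (1 + ‖x‖) ^ l) ^ n := by
    intro x
    refine norm_iteratedFDeriv_comp_le (N := ((⊤ : ℕ∞) : WithTop ℕ∞)) Real.contDiff_exp hf.1 (by exact_mod_cast le_top) x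
      ?_ ?_
    · intro i _
      rw [norm_iteratedFDeriv_eq_norm_iteratedDeriv, iteratedDeriv_eq_iterate,
        Real.iter_deriv_exp, Real.norm_eq_abs, Real.abs_exp]
    · intro i hi hin
      -- The composition bound asks for the `i`-th derivative to be at most the `i`-th power of a
      -- base. Using `C + 1` makes the base at least `1`, so a first-power bound suffices.
      have h1 : (1 : ℝ) ≤ (1 + ‖x‖) ^ l := one_le_pow₀ (by linarith [norm_nonneg x])
      calc _ ≤ C * (1 + ‖x‖) ^ l := hC i hin x
        _ ≤ (C + 1) * (1 + ‖x‖) ^ l := by gcongr; linarith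
        _ ≤ _ := le_self_pow₀ (by nlinarith) (by omega)
  refine ⟨n.factorial * (C + 1) ^ n *
    ((2 / b) ^ (k + l * n) * (k + l * n).factorial * Real.exp b), fun x => ?_⟩
  calc _ ≤ (1 + ‖x‖) ^ k *
        (n.factorial * Real.exp (-b * ‖x‖ ^ 2) * ((C + 1) * (1 + ‖x‖) ^ l) ^ n) := by
        gcongr
        · linarith
        · exact key x
    _ = n.factorial * (C + 1) ^ n * ((1 + ‖x‖) ^ (k + l * n) * Real.exp (-b * ‖x‖ ^ 2)) := by
        rw [mul_pow, ← pow_mul, pow_add]; ring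
    _ ≤ _ := by
        exact mul_le_mul_of_nonneg_left
          (one_add_pow_mul_exp_neg_mul_sq_le hb _ (norm_nonneg x)) (by positivity)

/-- The Gaussian `x ↦ exp (-b ‖x‖²)` as a real Schwartz function. -/
noncomputable def realGaussianSchwartz (V : Type*) [NormedAddCommGroup V] [InnerProductSpace ℝ V]
    (b : ℝ) (hb : 0 < b) : 𝓢(V, ℝ) where
  toFun x := Real.exp (-b * ‖x‖ ^ 2)
  smooth' := Real.contDiff_exp.comp (contDiff_const.mul (contDiff_norm_sq ℝ))
  decay' k n := exists_decay_exp_neg_mul_sq hb k n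

/-- The Gaussian `x ↦ exp (-b ‖x - z‖²)` as a complex Schwartz function. -/
noncomputable def gaussianSchwartz {b : ℝ} (hb : 0 < b) (z : V) : 𝓢(V, ℂ) :=
  SchwartzMap.compSubConstCLM ℝ z
    (SchwartzMap.postcompCLM Complex.ofRealCLM (realGaussianSchwartz V b hb))

theorem gaussianSchwartz_apply {b : ℝ} (hb : 0 < b) (z x : V) :
    gaussianSchwartz hb z x = (Real.exp (-b * ‖x - z‖ ^ 2) : ℝ) := by
  simp only [gaussianSchwartz, SchwartzMap.compSubConstCLM_apply, SchwartzMap.postcompCLM_apply]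
  rfl

/-- The dilation `φ ↦ φ(r ·)` of Schwartz functions. -/
noncomputable def schwartzDilation (r : ℝ) (hr : r ≠ 0) : 𝓢(V, ℂ) →L[ℂ] 𝓢(V, ℂ) :=
  SchwartzMap.compCLMOfContinuousLinearEquiv ℂ (ContinuousLinearEquiv.smulLeft (Units.mk0 r hr))

theorem schwartzDilation_apply (r : ℝ) (hr : r ≠ 0) (φ : 𝓢(V, ℂ)) (x : V) :
    schwartzDilation r hr φ x = φ (r • x) := rfl

/-- Change of variables `v ↦ r v` in the Fourier integral; the Jacobian is the factor `r^(-dim)`. -/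
theorem fourier_schwartzDilation [FiniteDimensional ℝ V] [MeasurableSpace V] [BorelSpace V]
    {r : ℝ} (hr : 0 < r) (φ : 𝓢(V, ℂ)) (x : V) :
    𝓕 (schwartzDilation r hr.ne' φ) x
      = ((r ^ Module.finrank ℝ V)⁻¹ : ℝ) * 𝓕 φ (r⁻¹ • x) := by
  rw [SchwartzMap.fourier_coe, SchwartzMap.fourier_coe, Real.fourier_eq, Real.fourier_eq]
  have := Measure.integral_comp_smul (volume : Measure V)
    (fun v => Real.fourierChar (-(inner ℝ v (r⁻¹ • x))) • φ v) r
  rw [abs_of_nonneg (by positivity)] at this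
  rw [← Complex.real_smul, ← this]
  congr 1
  ext v
  rw [schwartzDilation_apply, inner_smul_left, inner_smul_right]
  simp [hr.ne']

end GaussianSchwartz

/-! ### Geometric Riemann sums along a ray -/

section Ray

/-- Integration by parts against `t - ρa` leaves the remainder `∫ (ρa - t) F'(t)`. Since `ρa - t ≤
(ρ - 1) t` for `t ≥ a`, the decay of `t F'(t)` bounds it by an arctangent increment. These
increments telescope over consecutive intervals, so the total error stays of order `ρ - 1` however
many are used. -/
theorem intervalIntegral_le_left_mul_add {F F' : ℝ → ℝ} (hF : ∀ t, HasDerivAt F (F' t) t)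
    (hF' : Continuous F') {M : ℝ} (hM : ∀ t, 0 < t → |F' t| * t ≤ M * (1 + t ^ 2)⁻¹)
    {ρ a : ℝ} (hρ : 1 < ρ) (ha : 0 < a) :
    ∫ t in a..ρ * a, F t ≤ (ρ - 1) * a * F a
      + (ρ - 1) * (M * (Real.arctan (ρ * a) - Real.arctan a)) := by
  have hle : a ≤ ρ * a := by nlinarith
  have hFc : Continuous F := continuous_iff_continuousAt.2 fun t => (hF t).continuousAt
  have hparts : ∫ t in a..ρ * a, F t = (ρ - 1) * a * F a + ∫ t in a..ρ * a, (ρ * a - t) * F' t := by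
    have h := intervalIntegral.integral_mul_deriv_eq_deriv_mul (a := a) (b := ρ * a)
      (u := F) (v := fun t => t - ρ * a) (u' := F') (v' := fun _ => 1)
      (fun t _ => hF t) (fun t _ => (hasDerivAt_id t).sub_const _)
      (hF'.intervalIntegrable _ _) (by simp)
    simp only [mul_one, sub_self, mul_zero, zero_sub] at h
    rw [h, ← sub_eq_zero]
    have : ∫ t in a..ρ * a, (ρ * a - t) * F' t = - ∫ t in a..ρ * a, F' t * (t - ρ * a) := by
      rw [← intervalIntegral.integral_neg]
      congr 1; ext t; ring
    rw [this]; ring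
  have hbound : ∫ t in a..ρ * a, (ρ * a - t) * F' t
      ≤ ∫ t in a..ρ * a, (ρ - 1) * (M * (1 + t ^ 2)⁻¹) := by
    refine intervalIntegral.integral_mono_on hle
      (Continuous.intervalIntegrable (by fun_prop) _ _)
      (Continuous.intervalIntegrable ?_ _ _) ?_
    · have : ∀ t : ℝ, 1 + t ^ 2 ≠ 0 := fun t => by positivity
      fun_prop (disch := assumption)
    · intro t ht
      have ht0 : 0 < t := ha.trans_le ht.1
      calc (ρ * a - t) * F' t ≤ (ρ * a - t) * |F' t| :=
            mul_le_mul_of_nonneg_left (le_abs_self _) (by linarith [ht.2])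
        _ ≤ ((ρ - 1) * t) * |F' t| :=
            mul_le_mul_of_nonneg_right (by nlinarith [ht.1]) (abs_nonneg _)
        _ = (ρ - 1) * (|F' t| * t) := by ring
        _ ≤ _ := mul_le_mul_of_nonneg_left (hM t ht0) (by linarith)
  rw [intervalIntegral.integral_const_mul, intervalIntegral.integral_const_mul,
    integral_inv_one_add_sq] at hbound
  linarith

theorem intervalIntegral_le_geometric_sum {F F' : ℝ → ℝ} (hF : ∀ t, HasDerivAt F (F' t) t)
    (hF' : Continuous F') {M : ℝ} (hM : ∀ t, 0 < t → |F' t| * t ≤ M * (1 + t ^ 2)⁻¹)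
    {ρ s : ℝ} (hρ : 1 < ρ) (hs : 0 < s) (N : ℕ) :
    ∫ t in s..ρ ^ N * s, F t ≤ (ρ - 1) * s * (∑ k ∈ Finset.range N, ρ ^ k * F (ρ ^ k * s))
      + (ρ - 1) * (M * (Real.arctan (ρ ^ N * s) - Real.arctan s)) := by
  have hFc : Continuous F := continuous_iff_continuousAt.2 fun t => (hF t).continuousAt
  induction N with
  | zero => simp
  | succ N ih =>
    have hpos : 0 < ρ ^ N * s := by positivity
    have h := intervalIntegral_le_left_mul_add hF hF' hM hρ hpos
    rw [← mul_assoc, ← pow_succ'] at h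
    rw [← intervalIntegral.integral_add_adjacent_intervals
      (hFc.intervalIntegrable s (ρ ^ N * s)) (hFc.intervalIntegrable _ _), Finset.sum_range_succ]
    linarith

theorem exp_neg_mul_sq_le_inv {b t : ℝ} (hb : 0 < b) (ht : 0 < t) :
    Real.exp (-b * t ^ 2) ≤ (b * t ^ 2)⁻¹ := by
  rw [neg_mul, Real.exp_neg]
  gcongr
  linarith [Real.add_one_le_exp (b * t ^ 2)]

theorem setIntegral_Ioi_le_of_gaussian_bound {F : ℝ → ℝ} (hFc : Continuous F) {D b : ℝ}
    (hD : 0 < D) (hb : 0 < b) (hFD : ∀ t, 0 ≤ t → |F t| ≤ D * Real.exp (-b * t ^ 2)) {T : ℝ}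
    (hT : 0 < T) : ∫ t in Set.Ioi T, F t ≤ D / (b * T) := by
  have hint : IntegrableOn (fun t : ℝ => D / b * t ^ (-2 : ℝ)) (Set.Ioi T) :=
    (integrableOn_Ioi_rpow_of_lt (by norm_num) hT).const_mul _
  have hbd : ∀ t ∈ Set.Ioi T, |F t| ≤ D / b * t ^ (-2 : ℝ) := by
    intro t ht
    have ht0 : 0 < t := hT.trans ht
    refine (hFD t ht0.le).trans ?_
    calc D * Real.exp (-b * t ^ 2) ≤ D * (b * t ^ 2)⁻¹ :=
          mul_le_mul_of_nonneg_left (exp_neg_mul_sq_le_inv hb ht0) hD.le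
      _ = _ := by
          rw [Real.rpow_neg ht0.le, Real.rpow_two, mul_inv]; ring
  calc ∫ t in Set.Ioi T, F t ≤ ∫ t in Set.Ioi T, D / b * t ^ (-2 : ℝ) := by
        refine setIntegral_mono_on ?_ hint measurableSet_Ioi fun t ht => (le_abs_self _).trans (hbd t ht)
        exact hint.mono' hFc.aestronglyMeasurable.restrict
          ((ae_restrict_mem measurableSet_Ioi).mono hbd)
    _ = D / (b * T) := by
        rw [integral_const_mul, integral_Ioi_rpow_of_lt (by norm_num) hT]
        norm_num
        rw [Real.rpow_neg hT.le, Real.rpow_one]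
        field_simp

/-- The point is uniformity: `ρ` and `C` depend only on `D, b, c, M`, so they serve all rays, all
starting points `s` and all `N` at once. If the samples run from near `0` to far out, the sum
captures the positive integral; otherwise one of the two Gaussian terms compensates for the missing
end. -/
theorem exists_compensated_geometric_sum_nonneg {D b c M : ℝ} (hD : 0 < D) (hb : 0 < b)
    (hc : 0 < c) (hM0 : 0 < M) :
    ∃ ρ C : ℝ, 1 < ρ ∧ 0 ≤ C ∧ ∀ (N : ℕ) (F F' : ℝ → ℝ), (∀ t, HasDerivAt F (F' t) t) →
      Continuous F' → (∀ t, 0 < t → |F' t| * t ≤ M * (1 + t ^ 2)⁻¹) →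
      (∀ t, 0 ≤ t → |F t| ≤ D * Real.exp (-b * t ^ 2)) → c ≤ ∫ t in Set.Ioi 0, F t →
      ∀ s, 0 ≤ s → 0 ≤ ∑ k ∈ Finset.range N, ρ ^ k * F (ρ ^ k * s)
        + C * Real.exp (-(b / 2) * s ^ 2) + C * (ρ ^ N * Real.exp (-(b / 2) * (ρ ^ N * s) ^ 2)) := by
  -- The constants are tuned so that the Riemann error, the integral over `[0, δ]` and the tail
  -- beyond `K` each cost at most `c / 4`, leaving `c / 4` of the ray integral.
  set ρ : ℝ := 1 + c / (2 * Real.pi * M) with hρdef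
  set δ : ℝ := c / (4 * D) with hδ
  set K : ℝ := 4 * D / (b * c) with hK
  have hpi := Real.pi_pos
  have hρ1 : 0 < ρ - 1 := by rw [hρdef, add_sub_cancel_left]; positivity
  have hρ : 1 < ρ := by linarith
  have hρ0 : 0 < ρ := by linarith
  have hδ0 : 0 < δ := by positivity
  have hK0 : 0 < K := by positivity
  set C₁ : ℝ := D / (ρ - 1) * Real.exp (b / 2 * K ^ 2) with hC₁
  set C₂ : ℝ := 2 * D / (b * δ ^ 2) * (ρ / (ρ - 1)) with hC₂
  have hC₁0 : 0 < C₁ := by positivity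
  have hC₂0 : 0 < C₂ := by positivity
  refine ⟨ρ, C₁ + C₂, hρ, by positivity, ?_⟩
  intro N F F' hF hF' hM hFD hint s hs
  have hFc : Continuous F := continuous_iff_continuousAt.2 fun t => (hF t).continuousAt
  set S := ∑ k ∈ Finset.range N, ρ ^ k * F (ρ ^ k * s) with hS
  -- Samples stopping before `K`: the crude geometric bound `D ρ^N / (ρ - 1)` is absorbed by the
  -- outer Gaussian, which is bounded below on `[0, K]`.
  rcases le_total (ρ ^ N * s) K with hT | hT
  · have h1 : -(D * (ρ ^ N / (ρ - 1))) ≤ S := by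
      have habs : |S| ≤ ∑ k ∈ Finset.range N, ρ ^ k * D := by
        refine (Finset.abs_sum_le_sum_abs _ _).trans (Finset.sum_le_sum fun k _ => ?_)
        rw [abs_mul, abs_of_nonneg (by positivity : (0 : ℝ) ≤ ρ ^ k)]
        refine mul_le_mul_of_nonneg_left ((hFD _ (by positivity)).trans ?_) (by positivity)
        refine mul_le_of_le_one_right hD.le (Real.exp_le_one_iff.2 ?_)
        nlinarith [mul_nonneg hb.le (sq_nonneg (ρ ^ k * s))]
      rw [← Finset.sum_mul, geom_sum_eq hρ.ne'] at habs
      have : (ρ ^ N - 1) / (ρ - 1) * D ≤ D * (ρ ^ N / (ρ - 1)) := by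
        rw [mul_comm]
        gcongr
        linarith
      linarith [neg_abs_le S]
    have h2 : D * (ρ ^ N / (ρ - 1))
        ≤ C₁ * (ρ ^ N * Real.exp (-(b / 2) * (ρ ^ N * s) ^ 2)) := by
      have : 1 ≤ Real.exp (b / 2 * K ^ 2) * Real.exp (-(b / 2) * (ρ ^ N * s) ^ 2) := by
        rw [← Real.exp_add]
        apply Real.one_le_exp
        have : (ρ ^ N * s) ^ 2 ≤ K ^ 2 := by gcongr
        nlinarith
      calc D * (ρ ^ N / (ρ - 1)) = D / (ρ - 1) * ρ ^ N * 1 := by ring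
        _ ≤ D / (ρ - 1) * ρ ^ N *
            (Real.exp (b / 2 * K ^ 2) * Real.exp (-(b / 2) * (ρ ^ N * s) ^ 2)) := by gcongr
        _ = _ := by rw [hC₁]; ring
    have h3 : 0 ≤ (C₁ + C₂) * Real.exp (-(b / 2) * s ^ 2) := by positivity
    have h4 : 0 ≤ C₂ * (ρ ^ N * Real.exp (-(b / 2) * (ρ ^ N * s) ^ 2)) := by positivity
    linarith
  -- Samples starting beyond `δ`: half of the Gaussian exponent gives `exp(-(b/2) s²)`, the other
  -- half gives `ρ^(-2k)`, so the weighted terms sum geometrically and the inner Gaussian absorbs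
  -- them.
  rcases le_total δ s with hsδ | hsδ
  · have hs0 : 0 < s := hδ0.trans_le hsδ
    have habs : |S| ≤ ∑ k ∈ Finset.range N,
        2 * D / (b * δ ^ 2) * Real.exp (-(b / 2) * s ^ 2) * (ρ⁻¹) ^ k := by
      refine (Finset.abs_sum_le_sum_abs _ _).trans (Finset.sum_le_sum fun k _ => ?_)
      have hk1 : 1 ≤ ρ ^ k := one_le_pow₀ hρ.le
      have hk0 : 0 < ρ ^ k := by positivity
      set t := ρ ^ k * s with ht
      have hst : s ≤ t := by nlinarith
      have ht0 : 0 < t := by positivity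
      rw [abs_mul, abs_of_nonneg hk0.le]
      have e1 : Real.exp (-b * t ^ 2) ≤ Real.exp (-(b / 2) * s ^ 2) * ((b / 2) * t ^ 2)⁻¹ := by
        calc Real.exp (-b * t ^ 2) = Real.exp (-(b / 2) * t ^ 2) * Real.exp (-(b / 2) * t ^ 2) := by
              rw [← Real.exp_add]; ring_nf
          _ ≤ _ := by
              gcongr ?_ * ?_
              · apply Real.exp_le_exp.2
                have : s ^ 2 ≤ t ^ 2 := by gcongr
                nlinarith
              · exact exp_neg_mul_sq_le_inv (by positivity) ht0
      have e2 : ((b / 2) * t ^ 2)⁻¹ ≤ ((b / 2) * (ρ ^ k * δ) ^ 2)⁻¹ := by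
        rw [ht]; gcongr
      calc ρ ^ k * |F t| ≤ ρ ^ k * (D * Real.exp (-b * t ^ 2)) := by
            gcongr; exact hFD t ht0.le
        _ ≤ ρ ^ k * (D * (Real.exp (-(b / 2) * s ^ 2) * ((b / 2) * (ρ ^ k * δ) ^ 2)⁻¹)) := by
            gcongr
            exact e1.trans (by gcongr)
        _ = _ := by
            rw [inv_pow]; field_simp
    rw [← Finset.mul_sum] at habs
    have hgeo : ∑ k ∈ Finset.range N, (ρ⁻¹) ^ k ≤ ρ / (ρ - 1) := by
      have hlt : ρ⁻¹ < 1 := inv_lt_one_of_one_lt₀ hρ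
      have h := (summable_geometric_of_lt_one (inv_nonneg.2 hρ0.le) hlt).sum_le_tsum
        (Finset.range N) (fun k _ => by positivity)
      rw [tsum_geometric_of_lt_one (inv_nonneg.2 hρ0.le) hlt] at h
      refine h.trans_eq ?_
      field_simp
    have h5 : 2 * D / (b * δ ^ 2) * Real.exp (-(b / 2) * s ^ 2) * ∑ k ∈ Finset.range N, (ρ⁻¹) ^ k
        ≤ C₂ * Real.exp (-(b / 2) * s ^ 2) := by
      calc _ ≤ 2 * D / (b * δ ^ 2) * Real.exp (-(b / 2) * s ^ 2) * (ρ / (ρ - 1)) := by gcongr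
        _ = _ := by rw [hC₂]; ring
    have h3 : 0 ≤ C₁ * Real.exp (-(b / 2) * s ^ 2) := by positivity
    have h4 : 0 ≤ (C₁ + C₂) * (ρ ^ N * Real.exp (-(b / 2) * (ρ ^ N * s) ^ 2)) := by positivity
    linarith [neg_abs_le S]
  -- Samples cover `[δ, K]`: here the sum itself is positive. The case `s = 0` is excluded by `K ≤
  -- ρ^N s`.
  · have hs0 : 0 < s := by
      rcases hs.eq_or_lt with h | h
      · rw [← h] at hT; simp at hT; linarith
      · exact h
    set T := ρ ^ N * s with hTdef
    have hT0 : 0 < T := by positivity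
    have hInt : IntegrableOn F (Set.Ioi 0) := by
      refine Integrable.mono' (((integrable_exp_neg_mul_sq hb).const_mul D).integrableOn)
        hFc.aestronglyMeasurable.restrict ?_
      exact (ae_restrict_mem measurableSet_Ioi).mono fun t ht => hFD t (le_of_lt ht)
    have hsplit : ∫ t in Set.Ioi 0, F t
        = (∫ t in (0 : ℝ)..s, F t) + (∫ t in s..T, F t) + ∫ t in Set.Ioi T, F t := by
      rw [intervalIntegral.integral_add_adjacent_intervals (hFc.intervalIntegrable _ _)
        (hFc.intervalIntegrable _ _), intervalIntegral.integral_interval_add_Ioi hInt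
        (hInt.mono_set (Set.Ioi_subset_Ioi hT0.le))]
    have h1 : ∫ t in (0 : ℝ)..s, F t ≤ c / 4 := by
      have : ∫ t in (0 : ℝ)..s, F t ≤ ∫ t in (0 : ℝ)..s, D := by
        refine intervalIntegral.integral_mono_on hs (hFc.intervalIntegrable _ _) (by simp) ?_
        intro t ht
        refine (le_abs_self _).trans ((hFD t ht.1).trans ?_)
        refine mul_le_of_le_one_right hD.le (Real.exp_le_one_iff.2 ?_)
        nlinarith [mul_nonneg hb.le (sq_nonneg t)]
      rw [intervalIntegral.integral_const, sub_zero, smul_eq_mul] at this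
      refine this.trans ?_
      calc s * D ≤ δ * D := by gcongr
        _ = c / 4 := by rw [hδ]; field_simp
    have h2 : ∫ t in Set.Ioi T, F t ≤ c / 4 := by
      refine (setIntegral_Ioi_le_of_gaussian_bound hFc hD hb hFD hT0).trans ?_
      calc D / (b * T) ≤ D / (b * K) := by gcongr
        _ = c / 4 := by rw [hK]; field_simp
    have h3 := intervalIntegral_le_geometric_sum hF hF' hM hρ hs0 N
    have h4 : (ρ - 1) * (M * (Real.arctan T - Real.arctan s)) ≤ c / 4 := by
      have : Real.arctan T - Real.arctan s ≤ Real.pi / 2 := by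
        linarith [Real.arctan_lt_pi_div_two T, Real.arctan_pos.2 hs0]
      calc _ ≤ (ρ - 1) * (M * (Real.pi / 2)) := by gcongr
        _ = c / 4 := by rw [hρdef]; field_simp; ring
    have h5 : 0 < (ρ - 1) * s * S := by linarith
    have h6 : 0 < S := by
      by_contra hneg
      push Not at hneg
      have : (ρ - 1) * s * S ≤ 0 := mul_nonpos_of_nonneg_of_nonpos (by positivity) hneg
      linarith
    positivity

end Ray

/-! ### Positive functionals homogeneous under dilation -/

section Positivity

variable {V : Type*} [NormedAddCommGroup V] [InnerProductSpace ℝ V]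

theorem exists_unit_eq_norm_smul [Nontrivial V] (y : V) : ∃ θ : V, ‖θ‖ = 1 ∧ y = ‖y‖ • θ := by
  rcases eq_or_ne y 0 with rfl | hy
  · obtain ⟨θ, hθ⟩ := exists_norm_eq V zero_le_one
    exact ⟨θ, hθ, by simp⟩
  · refine ⟨‖y‖⁻¹ • y, ?_, ?_⟩
    · rw [norm_smul, norm_inv, norm_norm, inv_mul_cancel₀ (norm_ne_zero_iff.2 hy)]
    · rw [smul_smul, mul_inv_cancel₀ (norm_ne_zero_iff.2 hy), one_smul]

theorem exists_fderiv_schwartz_decay (φ : 𝓢(V, ℂ)) :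
    ∃ M : ℝ, 0 < M ∧ ∀ y : V, ‖fderiv ℝ φ y‖ * ‖y‖ ≤ M * (1 + ‖y‖ ^ 2)⁻¹ := by
  set ψ := SchwartzMap.fderivCLM ℝ V ℂ φ
  have h1 := SchwartzMap.norm_pow_mul_le_seminorm ℝ ψ 1
  have h3 := SchwartzMap.norm_pow_mul_le_seminorm ℝ ψ 3
  -- The weights `‖y‖` and `‖y‖³` add up to `‖y‖ (1 + ‖y‖²)`; the `+ 1` only makes `M` positive.
  refine ⟨SchwartzMap.seminorm ℝ 1 0 ψ + SchwartzMap.seminorm ℝ 3 0 ψ + 1, by positivity,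
    fun y => ?_⟩
  specialize h1 y
  specialize h3 y
  rw [SchwartzMap.fderivCLM_apply] at h1 h3
  rw [← div_eq_mul_inv, le_div_iff₀ (by positivity)]
  nlinarith

/-- A positive functional on Schwartz functions, homogeneous of degree `-1` under dilations, is
nonnegative at every Gaussian-bounded function whose integrals over rays are bounded below by a
positive constant. -/
theorem re_nonneg_of_ray_integral_pos [Nontrivial V] (Λ : 𝓢(V, ℂ) →ₗ[ℂ] ℂ)
    (hpos : ∀ φ : 𝓢(V, ℂ), (∀ x, 0 ≤ φ x) → 0 ≤ Λ φ)
    (hdil : ∀ (r : ℝ) (hr : 0 < r) (φ : 𝓢(V, ℂ)),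
      Λ (schwartzDilation r hr.ne' φ) = (r⁻¹ : ℝ) * Λ φ)
    (φ : 𝓢(V, ℂ)) (him : ∀ y, (φ y).im = 0) {D b c : ℝ} (hb : 0 < b) (hc : 0 < c)
    (hD : ∀ y, ‖φ y‖ ≤ D * Real.exp (-b * ‖y‖ ^ 2))
    (hray : ∀ θ : V, ‖θ‖ = 1 → c ≤ ∫ t in Set.Ioi (0 : ℝ), (φ (t • θ)).re) :
    0 ≤ (Λ φ).re := by
  obtain ⟨M, hM0, hM⟩ := exists_fderiv_schwartz_decay φ
  have hD' : ∀ y, ‖φ y‖ ≤ (|D| + 1) * Real.exp (-b * ‖y‖ ^ 2) := fun y => (hD y).trans (by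
    gcongr; linarith [le_abs_self D])
  obtain ⟨ρ, C, hρ, hC, hkey⟩ := exists_compensated_geometric_sum_nonneg
    (D := |D| + 1) (b := b) (c := c) (M := M) (by positivity) hb hc hM0
  have hρ0 : 0 < ρ := by linarith
  have hb2 : 0 < b / 2 := by positivity
  set G : 𝓢(V, ℂ) := gaussianSchwartz hb2 0 with hG
  have hpow : ∀ k : ℕ, 0 < ρ ^ k := fun k => pow_pos hρ0 k
  -- On each ray `Φ N` is exactly the compensated geometric sum, so it is pointwise nonnegative.
  set Φ : ℕ → 𝓢(V, ℂ) := fun N =>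
    (∑ k ∈ Finset.range N, ((ρ ^ k : ℝ) : ℂ) • schwartzDilation (ρ ^ k) (hpow k).ne' φ)
    + (C : ℂ) • G + (C : ℂ) • ((ρ ^ N : ℝ) : ℂ) • schwartzDilation (ρ ^ N) (hpow N).ne' G with hΦ
  have hΦpos : ∀ N x, 0 ≤ Φ N x := by
    intro N y
    obtain ⟨θ, hθ, hy⟩ := exists_unit_eq_norm_smul y
    set s := ‖y‖ with hs
    have hderiv : ∀ t : ℝ, HasDerivAt (fun t : ℝ => (φ (t • θ)).re)
        ((fderiv ℝ φ (t • θ) θ).re) t := by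
      intro t
      have h1 : HasDerivAt (fun t : ℝ => t • θ) θ t := by
        simpa using (hasDerivAt_id t).smul_const θ
      have h2 := (φ.hasFDerivAt (t • θ)).comp_hasDerivAt t h1
      exact (Complex.reCLM.hasFDerivAt.comp_hasDerivAt t h2)
    have hcont : Continuous fun t : ℝ => (fderiv ℝ φ (t • θ) θ).re := by
      have h1 : Continuous fun y => fderiv ℝ φ y := (SchwartzMap.fderivCLM ℝ V ℂ φ).continuous
      have h2 : Continuous fun t : ℝ => fderiv ℝ φ (t • θ) :=
        h1.comp (continuous_id.smul continuous_const)
      exact Complex.continuous_re.comp (h2.clm_apply continuous_const)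
    have hnorm : ∀ t : ℝ, 0 ≤ t → ‖t • θ‖ = t := fun t ht => by
      rw [norm_smul, hθ, mul_one, Real.norm_of_nonneg ht]
    have hmain := hkey N _ _ hderiv hcont
      (fun t ht => by
        have h := hM (t • θ)
        rw [hnorm t ht.le] at h
        refine le_trans ?_ h
        gcongr
        calc |(fderiv ℝ φ (t • θ) θ).re| ≤ ‖fderiv ℝ φ (t • θ) θ‖ := Complex.abs_re_le_norm _
          _ ≤ ‖fderiv ℝ φ (t • θ)‖ * ‖θ‖ := ContinuousLinearMap.le_opNorm _ _
          _ = _ := by rw [hθ, mul_one])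
      (fun t ht => by
        have h := hD' (t • θ)
        rw [hnorm t ht] at h
        exact (Complex.abs_re_le_norm _).trans h)
      (hray θ hθ) s (norm_nonneg y)
    have hreal : ∀ z, φ z = ((φ z).re : ℂ) := fun z => Complex.ext (by simp) (by simp [him])
    have hval : Φ N y = ((∑ k ∈ Finset.range N, ρ ^ k * (φ ((ρ ^ k * s) • θ)).re
        + C * Real.exp (-(b / 2) * s ^ 2)
        + C * (ρ ^ N * Real.exp (-(b / 2) * (ρ ^ N * s) ^ 2)) : ℝ) : ℂ) := by
      simp only [hΦ, add_apply, sum_apply, smul_apply,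
        schwartzDilation_apply, hG, gaussianSchwartz_apply, smul_eq_mul, sub_zero, norm_smul]
      rw [← hs, Real.norm_of_nonneg (hpow N).le]
      push_cast
      congr 2
      refine Finset.sum_congr rfl fun k _ => ?_
      conv_lhs => rw [hy, smul_smul, hreal]
    rw [hval]
    exact_mod_cast hmain
  -- The weight `ρ^k` cancels the homogeneity factor, so each dilate contributes `Λ φ` and both
  -- Gaussian terms contribute the same `C * Λ G`.
  have hΛ : ∀ N : ℕ, Λ (Φ N) = N * Λ φ + 2 * C * Λ G := by
    intro N
    simp only [hΦ, map_add, map_sum, map_smul, hdil _ (hpow _), smul_eq_mul]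
    have : ∀ (k : ℕ) (w : ℂ), ((ρ ^ k : ℝ) : ℂ) * (((ρ ^ k)⁻¹ : ℝ) * w) = w := by
      intro k w
      rw [← mul_assoc, ← Complex.ofReal_mul, mul_inv_cancel₀ (hpow k).ne']
      simp
    simp only [this, Finset.sum_const, Finset.card_range, nsmul_eq_mul]
    ring
  by_contra hneg
  push Not at hneg
  obtain ⟨N, hN⟩ := exists_nat_gt (2 * C * (Λ G).re / (-(Λ φ).re))
  rw [div_lt_iff₀ (by linarith)] at hN
  have h := hpos _ (hΦpos N)
  rw [hΛ, Complex.le_def] at h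
  have h1 := h.1
  simp at h1
  nlinarith

end Positivity

/-! ### Fourier transforms and hyperplane integrals of Gaussian combinations -/

section GaussianSpan

variable {V : Type*} [NormedAddCommGroup V] [InnerProductSpace ℝ V]

/-- The linear span of the translated Gaussians `x ↦ exp (-b ‖x - z‖²)`. -/
def gaussianSpan (V : Type*) [NormedAddCommGroup V] : Submodule ℝ (V → ℝ) :=
  Submodule.span ℝ {f | ∃ b : ℝ, 0 < b ∧ ∃ z : V, f = fun x => Real.exp (-b * ‖x - z‖ ^ 2)}

/-- Pythagoras for the splitting along `θ`. It shows that a translated Gaussian restricts to `θ^⊥`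
as a translated Gaussian times a constant. -/
theorem norm_sub_sq_of_mem_orthogonal {θ : V} (hθ : ‖θ‖ = 1) (z : V) (x : (ℝ ∙ θ)ᗮ) :
    ‖(x : V) - z‖ ^ 2 = inner ℝ z θ ^ 2 + ‖x - (ℝ ∙ θ)ᗮ.orthogonalProjectionOnto z‖ ^ 2 := by
  have hdec : (x : V) - z = (-(inner ℝ z θ)) • θ
      + ((x - (ℝ ∙ θ)ᗮ.orthogonalProjectionOnto z : (ℝ ∙ θ)ᗮ) : V) := by
    have h := Submodule.starProjection_add_starProjection_orthogonal z (K := ℝ ∙ θ)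
    rw [Submodule.starProjection_unit_singleton ℝ hθ] at h
    rw [Submodule.coe_sub, real_inner_comm]
    conv_lhs => rw [← h]
    rw [Submodule.starProjection_apply]
    module
  have horth : inner ℝ ((-(inner ℝ z θ)) • θ)
      ((x - (ℝ ∙ θ)ᗮ.orthogonalProjectionOnto z : (ℝ ∙ θ)ᗮ) : V) = 0 := by
    rw [inner_smul_left, Submodule.mem_orthogonal_singleton_iff_inner_right.1 (Subtype.prop _),
      mul_zero]
  rw [hdec, norm_add_sq_real, horth, norm_smul, hθ, mul_one, mul_zero, add_zero, Real.norm_eq_abs,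
    sq_abs, neg_sq]
  rfl

variable [FiniteDimensional ℝ V] [MeasurableSpace V] [BorelSpace V]

theorem fourierInv_gaussianSchwartz {b : ℝ} (hb : 0 < b) (z y : V) :
    𝓕⁻ (gaussianSchwartz hb z) y =
      (((Real.pi / b) ^ (Module.finrank ℝ V / 2 : ℝ) *
        Real.exp (-(Real.pi ^ 2 / b) * ‖y‖ ^ 2) : ℝ) : ℂ) *
        Complex.exp ((2 * Real.pi * inner ℝ z y : ℝ) * Complex.I) := by
  rw [SchwartzMap.fourierInv_coe, Real.fourierInv_eq',
    ← integral_add_right_eq_self _ z]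
  have hbc : 0 < (b : ℂ).re := by simpa using hb
  have hmain := GaussianFourier.integral_cexp_neg_mul_sq_norm_add hbc (2 * Real.pi * Complex.I) y
  have hpow : ((Real.pi : ℂ) / b) ^ (Module.finrank ℝ V / 2 : ℂ)
      = (((Real.pi / b) ^ (Module.finrank ℝ V / 2 : ℝ) : ℝ) : ℂ) := by
    rw [Complex.ofReal_cpow (by positivity)]; push_cast; rfl
  rw [hpow] at hmain
  have hexp : Complex.exp ((2 * Real.pi * Complex.I) ^ 2 * ‖y‖ ^ 2 / (4 * b))
      = ((Real.exp (-(Real.pi ^ 2 / b) * ‖y‖ ^ 2) : ℝ) : ℂ) := by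
    push_cast
    congr 1
    have : (b : ℂ) ≠ 0 := by exact_mod_cast hb.ne'
    rw [mul_pow, Complex.I_sq]
    field_simp
    ring
  rw [hexp, ← Complex.ofReal_mul] at hmain
  rw [← hmain, ← integral_mul_const]
  congr 1
  ext v
  rw [gaussianSchwartz_apply, add_sub_cancel_right, smul_eq_mul, Complex.ofReal_exp,
    ← Complex.exp_add, ← Complex.exp_add]
  congr 1
  rw [inner_add_left, real_inner_comm v y]
  push_cast
  ring

/-- The integrand is even, so this is half the real part of the Fourier integral of a
one-dimensional Gaussian. -/
theorem integral_Ioi_exp_neg_mul_sq_mul_cos {β : ℝ} (hβ : 0 < β) (γ : ℝ) :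
    ∫ t in Set.Ioi (0 : ℝ), Real.exp (-β * t ^ 2) * Real.cos (γ * t)
      = (Real.pi / β) ^ (1 / 2 : ℝ) * Real.exp (-γ ^ 2 / (4 * β)) / 2 := by
  have hβc : 0 < (β : ℂ).re := by simpa using hβ
  have h1 := fourierIntegral_gaussian hβc (γ : ℂ)
  have hpow : ((Real.pi : ℂ) / β) ^ (1 / 2 : ℂ) = (((Real.pi / β) ^ (1 / 2 : ℝ) : ℝ) : ℂ) := by
    rw [Complex.ofReal_cpow (by positivity)]; push_cast; rfl
  have hint : Integrable fun x : ℝ => Complex.exp (Complex.I * γ * x) * Complex.exp (-β * x ^ 2) := by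
    refine Integrable.mono' (integrable_exp_neg_mul_sq hβ) (by fun_prop) (.of_forall fun x => ?_)
    rw [norm_mul, Complex.norm_exp, Complex.norm_exp]
    have e1 : (Complex.I * γ * x).re = 0 := by simp
    have e2 : (-(β : ℂ) * x ^ 2).re = -β * x ^ 2 := by
      rw [show (-(β : ℂ) * x ^ 2) = ((-β * x ^ 2 : ℝ) : ℂ) by push_cast; ring, Complex.ofReal_re]
    rw [e1, e2, Real.exp_zero, one_mul]
  have h2 := congrArg Complex.re h1
  rw [hpow, show (-(γ : ℂ) ^ 2 / (4 * β)) = ((-γ ^ 2 / (4 * β) : ℝ) : ℂ) by push_cast; ring,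
    ← Complex.ofReal_exp, ← Complex.ofReal_mul, Complex.ofReal_re] at h2
  have h3 := integral_comp_abs (f := fun t => Real.exp (-β * t ^ 2) * Real.cos (γ * t))
  have h4 : ∫ t : ℝ, Real.exp (-β * |t| ^ 2) * Real.cos (γ * |t|)
      = (∫ x : ℝ, Complex.exp (Complex.I * γ * x) * Complex.exp (-β * x ^ 2)).re := by
    rw [show (∫ x : ℝ, Complex.exp (Complex.I * γ * x) * Complex.exp (-β * x ^ 2)).re
      = ∫ x : ℝ, (Complex.exp (Complex.I * γ * x) * Complex.exp (-β * x ^ 2)).re from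
        (integral_re hint).symm]
    congr 1
    ext t
    rw [show (-(β : ℂ) * t ^ 2) = ((-β * t ^ 2 : ℝ) : ℂ) by push_cast; ring, ← Complex.ofReal_exp,
      Complex.re_mul_ofReal, sq_abs,
      show Complex.I * γ * t = ((γ * t : ℝ) : ℂ) * Complex.I by push_cast; ring,
      Complex.exp_ofReal_mul_I_re, mul_comm]
    congr 1
    rcases abs_choice t with h | h <;> rw [h]
    rw [mul_neg, Real.cos_neg]
  rw [h4, h2] at h3
  linarith

theorem integral_addHaar_exp_neg_mul_norm_sub_sq {b : ℝ} (hb : 0 < b) (w : V) :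
    ∫ x, Real.exp (-b * ‖x - w‖ ^ 2) ∂(stdOrthonormalBasis ℝ V).toBasis.addHaar
      = (Real.pi / b) ^ (Module.finrank ℝ V / 2 : ℝ) := by
  change ∫ x, Real.exp (-b * ‖x - w‖ ^ 2) = _
  rw [← GaussianFourier.integral_rexp_neg_mul_sq_norm hb]
  exact integral_sub_right_eq_self (fun x => Real.exp (-b * ‖x‖ ^ 2)) w

theorem integrable_addHaar_exp_neg_mul_norm_sub_sq {b : ℝ} (hb : 0 < b) (w : V) :
    Integrable (fun x => Real.exp (-b * ‖x - w‖ ^ 2))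
      (stdOrthonormalBasis ℝ V).toBasis.addHaar := by
  change Integrable (fun x => Real.exp (-b * ‖x - w‖ ^ 2))
  have h := (gaussianSchwartz hb w).integrable (μ := (volume : Measure V))
  refine h.re.congr (.of_forall fun x => ?_)
  simp only [gaussianSchwartz_apply]
  exact Complex.ofReal_re _

theorem integral_orthogonal_exp_neg_mul_norm_sub_sq {b : ℝ} (hb : 0 < b) (z : V) {θ : V}
    (hθ : ‖θ‖ = 1) :
    Integrable (fun x : (ℝ ∙ θ)ᗮ => Real.exp (-b * ‖(x : V) - z‖ ^ 2))
      (stdOrthonormalBasis ℝ (ℝ ∙ θ)ᗮ).toBasis.addHaar ∧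
    ∫ x : (ℝ ∙ θ)ᗮ, Real.exp (-b * ‖(x : V) - z‖ ^ 2)
        ∂(stdOrthonormalBasis ℝ (ℝ ∙ θ)ᗮ).toBasis.addHaar
      = (Real.pi / b) ^ ((Module.finrank ℝ V - 1) / 2 : ℝ) * Real.exp (-b * inner ℝ z θ ^ 2) := by
  have hrank : (Module.finrank ℝ (ℝ ∙ θ)ᗮ : ℝ) = Module.finrank ℝ V - 1 := by
    have h := (ℝ ∙ θ).finrank_add_finrank_orthogonal
    rw [finrank_span_singleton (by rintro rfl; simp at hθ)] at h
    rw [← h]; push_cast; ring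
  have hfun : (fun x : (ℝ ∙ θ)ᗮ => Real.exp (-b * ‖(x : V) - z‖ ^ 2)) = fun x =>
      Real.exp (-b * ‖x - (ℝ ∙ θ)ᗮ.orthogonalProjectionOnto z‖ ^ 2)
        * Real.exp (-b * inner ℝ z θ ^ 2) := by
    ext x
    rw [norm_sub_sq_of_mem_orthogonal hθ, ← Real.exp_add]
    ring_nf
  rw [hfun, integral_mul_const, integral_addHaar_exp_neg_mul_norm_sub_sq hb, hrank]
  exact ⟨(integrable_addHaar_exp_neg_mul_norm_sub_sq hb _).mul_const _, rfl⟩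

/-- For `ψ` in the Gaussian span, the even part of `ψ` is the Fourier transform of a real-valued
Gaussian-bounded Schwartz function whose integrals over rays are half the integrals of `ψ` over the
orthogonal hyperplanes. -/
theorem exists_schwartz_fourier_eq_of_mem_gaussianSpan {ψ : V → ℝ} (hψ : ψ ∈ gaussianSpan V) :
    ∃ φ : 𝓢(V, ℂ), (∀ x, 𝓕 φ x = ((ψ x + ψ (-x)) / 2 : ℝ)) ∧ (∀ y, (φ y).im = 0) ∧
      (∃ D b : ℝ, 0 < b ∧ ∀ y, ‖φ y‖ ≤ D * Real.exp (-b * ‖y‖ ^ 2)) ∧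
      ∀ θ : V, ‖θ‖ = 1 →
        Integrable (fun x : (ℝ ∙ θ)ᗮ => ψ x) (stdOrthonormalBasis ℝ (ℝ ∙ θ)ᗮ).toBasis.addHaar ∧
        ∫ t in Set.Ioi (0 : ℝ), (φ (t • θ)).re
          = (∫ x : (ℝ ∙ θ)ᗮ, ψ x ∂(stdOrthonormalBasis ℝ (ℝ ∙ θ)ᗮ).toBasis.addHaar) / 2 := by
  have hrayint : ∀ (φ : 𝓢(V, ℂ)) (D b : ℝ), 0 < b →
      (∀ y, ‖φ y‖ ≤ D * Real.exp (-b * ‖y‖ ^ 2)) → ∀ θ : V, ‖θ‖ = 1 →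
      IntegrableOn (fun t : ℝ => (φ (t • θ)).re) (Set.Ioi 0) := by
    intro φ D b hb hD θ hθ
    refine Integrable.mono' (((integrable_exp_neg_mul_sq hb).const_mul D).integrableOn)
      ?_ (.of_forall fun t => ?_)
    · have : Continuous fun t : ℝ => (φ (t • θ)).re :=
        Complex.continuous_re.comp (φ.continuous.comp (by fun_prop))
      exact this.aestronglyMeasurable.restrict
    · refine (Complex.abs_re_le_norm _).trans ((hD _).trans_eq ?_)
      rw [norm_smul, hθ, mul_one, Real.norm_eq_abs, sq_abs]
  induction hψ using Submodule.span_induction with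
  | mem ψ h =>
    obtain ⟨b, hb, z, rfl⟩ := h
    set A : ℝ := (Real.pi / b) ^ (Module.finrank ℝ V / 2 : ℝ) with hA
    have hA0 : 0 ≤ A := by positivity
    -- Averaging over `z` and `-z` turns the character into a cosine, which makes `φ` real; the
    -- price is that only the even part of `ψ` is recovered.
    set φ : 𝓢(V, ℂ) := (2⁻¹ : ℂ) • (𝓕⁻ (gaussianSchwartz hb z) + 𝓕⁻ (gaussianSchwartz hb (-z)))
      with hφ
    have hφval : ∀ y, φ y = ((A * (Real.exp (-(Real.pi ^ 2 / b) * ‖y‖ ^ 2) *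
        Real.cos (2 * Real.pi * inner ℝ z y)) : ℝ) : ℂ) := by
      intro y
      simp only [hφ, smul_apply, add_apply, fourierInv_gaussianSchwartz, inner_neg_left, smul_eq_mul]
      rw [← mul_add, mul_neg, Complex.ofReal_neg, Complex.ofReal_mul A (_ * _),
        Complex.ofReal_mul _ (Real.cos _), Complex.ofReal_cos, Complex.cos, Complex.ofReal_mul A]
      ring
    refine ⟨φ, ?_, ?_, ⟨A, Real.pi ^ 2 / b, by positivity, ?_⟩, ?_⟩
    · intro x
      have : 𝓕 φ = (2⁻¹ : ℂ) • (gaussianSchwartz hb z + gaussianSchwartz hb (-z)) := by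
        rw [hφ, FourierTransform.fourier_smul, FourierTransform.fourier_add,
          FourierTransform.fourier_fourierInv_eq, FourierTransform.fourier_fourierInv_eq]
      rw [this, smul_apply, add_apply, gaussianSchwartz_apply, gaussianSchwartz_apply,
        smul_eq_mul, show x - -z = -(-x - z) by abel, norm_neg]
      push_cast
      ring
    · intro y
      rw [hφval, Complex.ofReal_im]
    · intro y
      rw [hφval, Complex.norm_real, Real.norm_eq_abs, abs_mul, abs_of_nonneg hA0, abs_mul,
        Real.abs_exp]
      exact mul_le_mul_of_nonneg_left
        (mul_le_of_le_one_right (Real.exp_pos _).le (Real.abs_cos_le_one _)) hA0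
    · intro θ hθ
      obtain ⟨h1, h2⟩ := integral_orthogonal_exp_neg_mul_norm_sub_sq hb z hθ
      refine ⟨h1, ?_⟩
      rw [h2]
      have hfun : (fun t : ℝ => (φ (t • θ)).re) = fun t => A *
          (Real.exp (-(Real.pi ^ 2 / b) * t ^ 2) * Real.cos ((2 * Real.pi * inner ℝ z θ) * t)) := by
        ext t
        rw [hφval, Complex.ofReal_re, norm_smul, hθ, mul_one, Real.norm_eq_abs, sq_abs,
          inner_smul_right]
        ring_nf
      rw [hfun, integral_const_mul, integral_Ioi_exp_neg_mul_sq_mul_cos (by positivity)]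
      have e1 : -(2 * Real.pi * inner ℝ z θ) ^ 2 / (4 * (Real.pi ^ 2 / b))
          = -b * inner ℝ z θ ^ 2 := by
        field_simp; ring
      -- The one-dimensional ray integral contributes `(π/b)^(-1/2)`, lowering the exponent from
      -- `dim/2` to that of the hyperplane.
      have e2 : A * (Real.pi / (Real.pi ^ 2 / b)) ^ (1 / 2 : ℝ)
          = (Real.pi / b) ^ ((Module.finrank ℝ V - 1) / 2 : ℝ) := by
        rw [show Real.pi / (Real.pi ^ 2 / b) = (Real.pi / b)⁻¹ by field_simp,
          Real.inv_rpow (by positivity), ← Real.rpow_neg (by positivity), hA,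
          ← Real.rpow_add (by positivity)]
        congr 1; ring
      rw [e1, ← e2]
      ring
  | zero =>
    refine ⟨0, fun x => ?_, fun y => by simp, ⟨0, 1, one_pos, fun y => by simp⟩,
      fun θ _ => ⟨by simp, by simp⟩⟩
    have : 𝓕 (0 : 𝓢(V, ℂ)) = 0 := FourierTransform.fourier_zero ..
    rw [this]; simp
  | add ψ₁ ψ₂ _ _ h₁ h₂ =>
    obtain ⟨φ₁, hF₁, him₁, ⟨D₁, b₁, hb₁, hD₁⟩, hr₁⟩ := h₁
    obtain ⟨φ₂, hF₂, him₂, ⟨D₂, b₂, hb₂, hD₂⟩, hr₂⟩ := h₂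
    refine ⟨φ₁ + φ₂, fun x => ?_, fun y => by simp [him₁, him₂],
      ⟨|D₁| + |D₂|, min b₁ b₂, lt_min hb₁ hb₂, fun y => ?_⟩, fun θ hθ => ⟨?_, ?_⟩⟩
    · rw [FourierTransform.fourier_add, add_apply, hF₁, hF₂]
      simp only [Pi.add_apply]
      push_cast; ring
    · rw [add_apply, add_mul]
      refine (norm_add_le _ _).trans (add_le_add ((hD₁ y).trans ?_) ((hD₂ y).trans ?_))
      · gcongr ?_ * ?_
        · exact le_abs_self _
        · apply Real.exp_le_exp.2
          nlinarith [min_le_left b₁ b₂, sq_nonneg ‖y‖]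
      · gcongr ?_ * ?_
        · exact le_abs_self _
        · apply Real.exp_le_exp.2
          nlinarith [min_le_right b₁ b₂, sq_nonneg ‖y‖]
    · exact (hr₁ θ hθ).1.add (hr₂ θ hθ).1
    · simp only [add_apply, Complex.add_re, Pi.add_apply]
      rw [integral_add (hrayint _ _ _ hb₁ hD₁ θ hθ) (hrayint _ _ _ hb₂ hD₂ θ hθ),
        (hr₁ θ hθ).2, (hr₂ θ hθ).2, integral_add (hr₁ θ hθ).1 (hr₂ θ hθ).1]
      ring
  | smul a ψ _ h =>
    obtain ⟨φ, hF, him, ⟨D, b, hb, hD⟩, hr⟩ := h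
    refine ⟨(a : ℂ) • φ, fun x => ?_, fun y => by simp [him],
      ⟨|a| * D, b, hb, fun y => ?_⟩, fun θ hθ => ⟨?_, ?_⟩⟩
    · rw [FourierTransform.fourier_smul, smul_apply, hF]
      simp only [Pi.smul_apply, smul_eq_mul]
      push_cast; ring
    · rw [smul_apply, norm_smul, Complex.norm_real, Real.norm_eq_abs, mul_assoc]
      exact mul_le_mul_of_nonneg_left (hD y) (abs_nonneg _)
    · exact (hr θ hθ).1.const_mul a
    · simp only [smul_apply, smul_eq_mul, Complex.re_ofReal_mul, Pi.smul_apply]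
      rw [integral_const_mul, integral_const_mul, (hr θ hθ).2]
      ring

end GaussianSpan

/-! ### Weighted uniform approximation by Gaussian combinations -/

section Approximation

variable {V : Type*} [NormedAddCommGroup V] [InnerProductSpace ℝ V]

/-- Completing the square: two Gaussians multiply to a constant times a Gaussian centred at the
weighted mean of their centres. -/
theorem mul_mem_gaussianSpan {f g : V → ℝ} (hf : f ∈ gaussianSpan V) (hg : g ∈ gaussianSpan V) :
    f * g ∈ gaussianSpan V := by
  induction hf, hg using Submodule.span_induction₂ with
  | mem_mem f g hf hg =>
    obtain ⟨a, ha, z, rfl⟩ := hf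
    obtain ⟨b, hb, w, rfl⟩ := hg
    have hab : a + b ≠ 0 := by positivity
    have key : (fun x : V => Real.exp (-a * ‖x - z‖ ^ 2)) * (fun x => Real.exp (-b * ‖x - w‖ ^ 2))
        = Real.exp (-(a * b / (a + b)) * ‖z - w‖ ^ 2) •
          fun x : V => Real.exp (-(a + b) * ‖x - (a + b)⁻¹ • (a • z + b • w)‖ ^ 2) := by
      ext x
      simp only [Pi.mul_apply, Pi.smul_apply, smul_eq_mul]
      rw [← Real.exp_add, ← Real.exp_add]
      congr 1
      simp only [norm_sub_sq_real, norm_smul, norm_add_sq_real, inner_smul_right, inner_smul_left,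
        inner_add_right, mul_pow, Real.norm_eq_abs, sq_abs]
      simp only [conj_trivial]
      field_simp
      ring
    rw [key]
    exact Submodule.smul_mem _ _ (Submodule.subset_span ⟨a + b, by positivity, _, rfl⟩)
  | zero_left g hg => rw [zero_mul]; exact Submodule.zero_mem _
  | zero_right f hf => rw [mul_zero]; exact Submodule.zero_mem _
  | add_left f₁ f₂ g _ _ _ h₁ h₂ => rw [add_mul]; exact Submodule.add_mem _ h₁ h₂
  | add_right f g₁ g₂ _ _ _ h₁ h₂ => rw [mul_add]; exact Submodule.add_mem _ h₁ h₂
  | smul_left r f g _ _ h => rw [smul_mul_assoc]; exact Submodule.smul_mem _ _ h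
  | smul_right r f g _ _ h => rw [mul_smul_comm]; exact Submodule.smul_mem _ _ h

theorem tendsto_gaussian_cocompact [FiniteDimensional ℝ V] {b : ℝ} (hb : 0 < b) (z : V) :
    Filter.Tendsto (fun x : V => Real.exp (-b * ‖x - z‖ ^ 2)) (Filter.cocompact V) (nhds 0) := by
  have h := ((gaussianSchwartz hb z).tendsto_cocompact).norm
  rw [norm_zero] at h
  refine h.congr fun x => ?_
  rw [gaussianSchwartz_apply, Complex.norm_real, Real.norm_eq_abs, Real.abs_exp]

/-- The Gaussian span plus constants, as a subalgebra of the continuous functions on the one-point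
compactification. -/
def gaussianSubalgebra (V : Type*) [NormedAddCommGroup V] [InnerProductSpace ℝ V] :
    Subalgebra ℝ C(OnePoint V, ℝ) where
  carrier := {F | (fun x : V => F x - F OnePoint.infty) ∈ gaussianSpan V}
  mul_mem' {F G} hF hG := by
    have h : (fun x : V => (F * G) x - (F * G) OnePoint.infty) =
        (fun x : V => F x - F OnePoint.infty) * (fun x : V => G x - G OnePoint.infty)
        + F OnePoint.infty • (fun x : V => G x - G OnePoint.infty)
        + G OnePoint.infty • (fun x : V => F x - F OnePoint.infty) := by
      ext x
      simp only [ContinuousMap.mul_apply, Pi.add_apply, Pi.mul_apply, Pi.smul_apply, smul_eq_mul]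
      ring
    simp only [Set.mem_ofPred_eq]
    rw [h]
    exact Submodule.add_mem _ (Submodule.add_mem _ (mul_mem_gaussianSpan hF hG)
      (Submodule.smul_mem _ _ hG)) (Submodule.smul_mem _ _ hF)
  add_mem' {F G} hF hG := by
    have h : (fun x : V => (F + G) x - (F + G) OnePoint.infty) =
        (fun x : V => F x - F OnePoint.infty) + (fun x : V => G x - G OnePoint.infty) := by
      ext x
      simp only [ContinuousMap.add_apply, Pi.add_apply]
      ring
    simp only [Set.mem_ofPred_eq]
    rw [h]
    exact Submodule.add_mem _ hF hG
  algebraMap_mem' r := by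
    have h : (fun x : V => algebraMap ℝ C(OnePoint V, ℝ) r x
        - algebraMap ℝ C(OnePoint V, ℝ) r OnePoint.infty) = 0 := by
      ext x
      exact sub_self _
    simp only [Set.mem_ofPred_eq]
    rw [h]
    exact Submodule.zero_mem _

/-- The Gaussian centred at a finite point `x` has its strict maximum there and vanishes at
infinity, so it separates `x` from every other point. -/
theorem gaussianSubalgebra_separatesPoints [FiniteDimensional ℝ V] :
    (gaussianSubalgebra V).SeparatesPoints := by
  have key : ∀ (x : V) (q : OnePoint V), (x : OnePoint V) ≠ q →
      ∃ F ∈ gaussianSubalgebra V, F x ≠ F q := by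
    intro x q hq
    have hc : Continuous fun y : V => Real.exp (-1 * ‖y - x‖ ^ 2) := by fun_prop
    refine ⟨OnePoint.continuousMapMk ⟨_, hc⟩ 0
      (by rw [Filter.coclosedCompact_eq_cocompact]; exact tendsto_gaussian_cocompact one_pos x),
      ?_, ?_⟩
    · change (fun y : V => Real.exp (-1 * ‖y - x‖ ^ 2) - 0) ∈ gaussianSpan V
      simp only [sub_zero]
      exact Submodule.subset_span ⟨1, one_pos, x, rfl⟩
    · change Real.exp (-1 * ‖x - x‖ ^ 2) ≠ _
      induction q with
      | infty => exact (Real.exp_pos _).ne'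
      | coe y =>
        change _ ≠ Real.exp (-1 * ‖y - x‖ ^ 2)
        intro h
        have h1 := Real.exp_injective h
        have hyx : y ≠ x := fun h => hq (by rw [h])
        have h2 : 0 < ‖y - x‖ := norm_pos_iff.2 (sub_ne_zero.2 hyx)
        simp only [sub_self, norm_zero] at h1
        nlinarith
  intro p q hpq
  induction p with
  | coe x =>
    obtain ⟨F, hF, h⟩ := key x q hpq
    exact ⟨F, ⟨F, hF, rfl⟩, h⟩
  | infty =>
    induction q with
    | infty => exact absurd rfl hpq
    | coe y =>
      obtain ⟨F, hF, h⟩ := key y _ hpq.symm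
      exact ⟨F, ⟨F, hF, rfl⟩, h.symm⟩

theorem exists_mem_gaussianSpan_near [FiniteDimensional ℝ V] {Q : V → ℝ} (hQ : Continuous Q)
    (hQ0 : Filter.Tendsto Q (Filter.cocompact V) (nhds 0)) {ε : ℝ} (hε : 0 < ε) :
    ∃ S ∈ gaussianSpan V, ∀ x, |S x - Q x| ≤ ε := by
  -- Stone–Weierstrass with tolerance `ε / 2`: subtracting the value at infinity, needed to land in
  -- the span, costs the other half.
  obtain ⟨⟨F, hF⟩, h⟩ :=
    ContinuousMap.exists_mem_subalgebra_near_continuousMap_of_separatesPoints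
      (gaussianSubalgebra V) gaussianSubalgebra_separatesPoints
      (OnePoint.continuousMapMk ⟨Q, hQ⟩ 0
        (by rw [Filter.coclosedCompact_eq_cocompact]; exact hQ0)) (ε / 2) (half_pos hε)
  have hle := fun p => (ContinuousMap.norm_coe_le_norm _ p).trans h.le
  have hinf : |F OnePoint.infty - 0| ≤ ε / 2 := hle OnePoint.infty
  refine ⟨_, hF, fun x => ?_⟩
  have hx : |F x - Q x| ≤ ε / 2 := hle x
  rw [abs_le] at *
  constructor <;> linarith

/-- Approximate `exp(‖x‖²) Q` uniformly, then multiply back by `exp(-‖x‖²)`; the span is closed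
under products. -/
theorem exists_mem_gaussianSpan_near_weighted [FiniteDimensional ℝ V] {Q : V → ℝ}
    (hQ : Continuous Q) (hQ0 : Filter.Tendsto (fun x => Real.exp (‖x‖ ^ 2) * Q x)
      (Filter.cocompact V) (nhds 0)) {ε : ℝ} (hε : 0 < ε) :
    ∃ ψ ∈ gaussianSpan V, ∀ x, |ψ x - Q x| ≤ ε * Real.exp (-‖x‖ ^ 2) := by
  obtain ⟨S, hS, h⟩ := exists_mem_gaussianSpan_near (by fun_prop) hQ0 hε
  have hg : (fun x : V => Real.exp (-1 * ‖x - 0‖ ^ 2)) ∈ gaussianSpan V :=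
    Submodule.subset_span ⟨1, one_pos, 0, rfl⟩
  refine ⟨_, mul_mem_gaussianSpan hS hg, fun x => ?_⟩
  have h1 : Real.exp (‖x‖ ^ 2) * Real.exp (-‖x‖ ^ 2) = 1 := by rw [← Real.exp_add]; simp
  have h2 : (S * fun x : V => Real.exp (-1 * ‖x - 0‖ ^ 2)) x - Q x
      = (S x - Real.exp (‖x‖ ^ 2) * Q x) * Real.exp (-‖x‖ ^ 2) := by
    simp only [Pi.mul_apply, sub_zero, neg_mul, one_mul]
    linear_combination Q x * h1
  rw [h2, abs_mul, Real.abs_exp]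
  exact mul_le_mul_of_nonneg_right (h x) (Real.exp_pos _).le

end Approximation

/-! ### Polar coordinates -/

section Polar

variable {E : Type*} [NormedAddCommGroup E] [NormedSpace ℝ E] [MeasurableSpace E] [BorelSpace E]
  [FiniteDimensional ℝ E] [Nontrivial E]

/-- Polar coordinates for functions that split into an angular and a radial factor. -/
theorem integral_eq_toSphere_mul_radial (μ : Measure E) [μ.IsAddHaarMeasure] {F : E → ℝ}
    {q : sphere (0 : E) 1 → ℝ} {w : ℝ → ℝ}
    (hF : ∀ (ξ : sphere (0 : E) 1) (r : ℝ), 0 < r → F (r • (ξ : E)) = q ξ * w r) :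
    ∫ x, F x ∂μ = (∫ ξ, q ξ ∂μ.toSphere) *
      ∫ r in Set.Ioi (0 : ℝ), r ^ (Module.finrank ℝ E - 1) * w r := by
  calc ∫ x, F x ∂μ = ∫ x : ({(0)}ᶜ : Set E), F x.1 ∂(μ.comap (↑)) := by
        rw [integral_subtype_comap (measurableSet_singleton _).compl F, restrict_compl_singleton]
    _ = ∫ x : ({(0)}ᶜ : Set E), (fun p : sphere (0 : E) 1 × Set.Ioi (0 : ℝ) => q p.1 * w p.2)
          (homeomorphUnitSphereProd E x) ∂(μ.comap (↑)) := by
        congr 1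
        ext x
        have hx : (x : E) ≠ 0 := x.2
        have h := hF (homeomorphUnitSphereProd E x).1 (homeomorphUnitSphereProd E x).2
          (homeomorphUnitSphereProd E x).2.2
        refine Eq.trans ?_ h
        congr 1
        simp [smul_smul, hx]
    _ = ∫ p : sphere (0 : E) 1 × Set.Ioi (0 : ℝ), q p.1 * w p.2
          ∂μ.toSphere.prod (.volumeIoiPow (Module.finrank ℝ E - 1)) :=
        μ.measurePreserving_homeomorphUnitSphereProd.integral_comp
          (Homeomorph.measurableEmbedding _)
          (fun p : sphere (0 : E) 1 × Set.Ioi (0 : ℝ) => q p.1 * w p.2)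
    _ = (∫ ξ, q ξ ∂μ.toSphere) *
          ∫ r : Set.Ioi (0 : ℝ), w r ∂.volumeIoiPow (Module.finrank ℝ E - 1) :=
        integral_prod_mul q fun r : Set.Ioi (0 : ℝ) => w r
    _ = _ := by
        simp only [Measure.volumeIoiPow, ENNReal.ofReal]
        rw [integral_withDensity_eq_integral_smul,
          integral_subtype_comap measurableSet_Ioi fun a ↦
            Real.toNNReal (a ^ (Module.finrank ℝ E - 1)) • w a,
          setIntegral_congr_fun measurableSet_Ioi fun x hx ↦ ?_]
        · rw [NNReal.smul_def, Real.coe_toNNReal _ (pow_nonneg hx.out.le _), smul_eq_mul]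
        · exact (measurable_subtype_coe.pow_const _).real_toNNReal

end Polar

/-! ### Homogeneous extensions and the duality inequality -/

section HomogeneousExtension

variable {n : ℕ}

theorem homogExt_smul (h : Sph n → ℝ) {r : ℝ} (hr : 0 < r) (x : Euc n) :
    homogExt h (r • x) = r⁻¹ * homogExt h x := by
  unfold homogExt
  by_cases hx : x = 0
  · simp [hx]
  · have hrx : r • x ≠ 0 := smul_ne_zero hr.ne' hx
    rw [dif_pos hrx, dif_pos hx, norm_smul, Real.norm_of_nonneg hr.le, mul_inv, mul_assoc]
    congr 3
    apply Subtype.ext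
    simp only [radialProj, norm_smul, Real.norm_of_nonneg hr.le, mul_inv, smul_smul]
    congr 1
    field_simp

theorem homogExt_coe_sphere (h : Sph n → ℝ) (ξ : Sph n) : homogExt h ξ = h ξ := by
  have hξ : ‖(ξ : Euc n)‖ = 1 := norm_eq_of_mem_sphere ξ
  have h0 : (ξ : Euc n) ≠ 0 := norm_ne_zero_iff.1 (by rw [hξ]; exact one_ne_zero)
  unfold homogExt
  rw [dif_pos h0, hξ, inv_one, one_mul]
  congr 1
  apply Subtype.ext
  simp [radialProj, hξ]

theorem homogExt_neg {h : Sph n → ℝ} (heven : ∀ ξ, h (-ξ) = h ξ) (x : Euc n) :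
    homogExt h (-x) = homogExt h x := by
  unfold homogExt
  by_cases hx : x = 0
  · simp [hx]
  · rw [dif_pos (neg_ne_zero.2 hx), dif_pos hx, norm_neg, ← heven]
    congr 2
    apply Subtype.ext
    simp [radialProj]

theorem homogExt_nonneg {h : Sph n → ℝ} (hh : ∀ ξ, 0 ≤ h ξ) (x : Euc n) : 0 ≤ homogExt h x := by
  unfold homogExt
  split_ifs
  · exact mul_nonneg (by positivity) (hh _)
  · exact le_rfl

theorem continuousOn_homogExt {h : Sph n → ℝ} (hh : Continuous h) :
    ContinuousOn (homogExt h) {0}ᶜ := by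
  rw [continuousOn_iff_continuous_domRestrict]
  have heq : Set.domRestrict {0}ᶜ (homogExt h) = fun x : ({0}ᶜ : Set (Euc n)) =>
      ‖(x : Euc n)‖⁻¹ * h (radialProj x x.2) := by
    ext x
    exact dif_pos x.2
  rw [heq]
  have hne : ∀ x : ({0}ᶜ : Set (Euc n)), ‖(x : Euc n)‖ ≠ 0 := fun x => norm_ne_zero_iff.2 x.2
  have hn : Continuous fun x : ({0}ᶜ : Set (Euc n)) => ‖(x : Euc n)‖⁻¹ :=
    (continuous_norm.comp continuous_subtype_val).inv₀ hne
  refine hn.mul (hh.comp (Continuous.subtype_mk ?_ _))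
  exact hn.smul continuous_subtype_val

theorem norm_mul_abs_homogExt_le {h : Sph n → ℝ} {C : ℝ} (hC : ∀ ξ, |h ξ| ≤ C) (hC0 : 0 ≤ C)
    (x : Euc n) : ‖x‖ * |homogExt h x| ≤ C := by
  unfold homogExt
  split_ifs with hx
  · rw [abs_mul, abs_inv, abs_norm, mul_inv_cancel_left₀ (norm_ne_zero_iff.2 hx)]
    exact hC _
  · simpa using hC0

/-- The function `x ↦ |x| exp (-2 |x|²) q(x / |x|)`. -/
noncomputable def radialGaussian (q : Sph n → ℝ) (x : Euc n) : ℝ :=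
  ‖x‖ ^ 2 * Real.exp (-2 * ‖x‖ ^ 2) * homogExt q x

theorem radialGaussian_smul (q : Sph n → ℝ) (ξ : Sph n) {r : ℝ} (hr : 0 < r) :
    radialGaussian q (r • (ξ : Euc n)) = q ξ * (r * Real.exp (-2 * r ^ 2)) := by
  unfold radialGaussian
  rw [homogExt_smul q hr, homogExt_coe_sphere, norm_smul, norm_eq_of_mem_sphere ξ, mul_one,
    Real.norm_of_nonneg hr.le]
  field_simp

theorem abs_radialGaussian_le {q : Sph n → ℝ} {C : ℝ} (hC : ∀ ξ, |q ξ| ≤ C) (hC0 : 0 ≤ C)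
    (x : Euc n) : |radialGaussian q x| ≤ C * (‖x‖ * Real.exp (-2 * ‖x‖ ^ 2)) := by
  unfold radialGaussian
  rw [abs_mul, abs_of_nonneg (by positivity : 0 ≤ ‖x‖ ^ 2 * Real.exp (-2 * ‖x‖ ^ 2))]
  calc _ = (‖x‖ * |homogExt q x|) * (‖x‖ * Real.exp (-2 * ‖x‖ ^ 2)) := by ring
    _ ≤ _ := by gcongr; exact norm_mul_abs_homogExt_le hC hC0 x

/-- The surplus in the exponent `-2` absorbs the factor `r` and still leaves `-3/2`, so that
`radialGaussian` decays even after multiplication by `exp(‖x‖²)`. -/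
theorem mul_exp_neg_two_mul_sq_le {r : ℝ} :
    r * Real.exp (-2 * r ^ 2) ≤ Real.exp (-(3 / 2) * r ^ 2) := by
  have h1 : r ≤ Real.exp (1 / 2 * r ^ 2) := by
    nlinarith [Real.add_one_le_exp (1 / 2 * r ^ 2), sq_nonneg (r - 1)]
  calc r * Real.exp (-2 * r ^ 2) ≤ Real.exp (1 / 2 * r ^ 2) * Real.exp (-2 * r ^ 2) := by gcongr
    _ = _ := by rw [← Real.exp_add]; ring_nf

theorem abs_radialGaussian_le_exp {q : Sph n → ℝ} {C : ℝ} (hC : ∀ ξ, |q ξ| ≤ C) (hC0 : 0 ≤ C)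
    (x : Euc n) : |radialGaussian q x| ≤ C * Real.exp (-(3 / 2) * ‖x‖ ^ 2) :=
  (abs_radialGaussian_le hC hC0 x).trans (mul_le_mul_of_nonneg_left mul_exp_neg_two_mul_sq_le hC0)

theorem exists_abs_le_of_continuous {q : Sph n → ℝ} (hq : Continuous q) :
    ∃ C, 0 ≤ C ∧ ∀ ξ, |q ξ| ≤ C := by
  obtain ⟨C, hC⟩ := isCompact_univ.exists_bound_of_continuousOn (f := q) hq.continuousOn
  exact ⟨max C 0, le_max_right _ _, fun ξ => (hC ξ trivial).trans (le_max_left _ _)⟩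

theorem continuous_radialGaussian {q : Sph n → ℝ} (hq : Continuous q) :
    Continuous (radialGaussian q) := by
  obtain ⟨C, hC0, hC⟩ := exists_abs_le_of_continuous hq
  rw [continuous_iff_continuousAt]
  intro x
  by_cases hx : x = 0
  · subst hx
    have h0 : radialGaussian q 0 = 0 := by simp [radialGaussian]
    rw [ContinuousAt, h0]
    refine squeeze_zero_norm (abs_radialGaussian_le hC hC0) ?_
    have : Continuous fun x : Euc n => C * (‖x‖ * Real.exp (-2 * ‖x‖ ^ 2)) := by fun_prop
    simpa using this.tendsto 0
  · have h1 : ContinuousAt (homogExt q) x :=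
      (continuousOn_homogExt hq).continuousAt (isOpen_compl_singleton.mem_nhds hx)
    have h2 : Continuous fun x : Euc n => ‖x‖ ^ 2 * Real.exp (-2 * ‖x‖ ^ 2) := by fun_prop
    exact h2.continuousAt.mul h1

theorem tendsto_exp_mul_radialGaussian {q : Sph n → ℝ} (hq : Continuous q) :
    Filter.Tendsto (fun x => Real.exp (‖x‖ ^ 2) * radialGaussian q x)
      (Filter.cocompact (Euc n)) (nhds 0) := by
  obtain ⟨C, hC0, hC⟩ := exists_abs_le_of_continuous hq
  have h := (tendsto_gaussian_cocompact (V := Euc n) (b := 1 / 2) (by norm_num) 0).const_mul C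
  rw [mul_zero] at h
  refine squeeze_zero_norm (fun x => ?_) h
  rw [norm_mul, Real.norm_eq_abs, Real.abs_exp, Real.norm_eq_abs, sub_zero]
  calc _ ≤ Real.exp (‖x‖ ^ 2) * (C * Real.exp (-(3 / 2) * ‖x‖ ^ 2)) := by
        gcongr; exact abs_radialGaussian_le_exp hC hC0 x
    _ = C * (Real.exp (‖x‖ ^ 2) * Real.exp (-(3 / 2) * ‖x‖ ^ 2)) := by ring
    _ = _ := by rw [← Real.exp_add]; ring_nf

theorem continuous_subSphIncl (θ : Sph n) : Continuous (subSphIncl θ) :=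
  Continuous.subtype_mk (continuous_subtype_val.comp continuous_subtype_val) _

theorem integral_pow_mul_exp_neg_two_mul_sq_pos (m : ℕ) :
    0 < ∫ r in Set.Ioi (0 : ℝ), r ^ m * Real.exp (-2 * r ^ 2) := by
  have h := integral_rpow_mul_exp_neg_mul_rpow (p := 2) (q := m) (b := 2) (by norm_num)
    (by linarith [(Nat.cast_nonneg m : (0 : ℝ) ≤ m)]) (by norm_num)
  simp only [Real.rpow_natCast, Real.rpow_two] at h
  rw [h]
  have := Real.Gamma_pos_of_pos (show (0 : ℝ) < (m + 1) / 2 by positivity)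
  positivity

instance (θ : Sph n) : (perpLebesgue θ).IsAddHaarMeasure := by
  unfold perpLebesgue; infer_instance

instance (θ : Sph n) : IsFiniteMeasure (subSurfaceMeasure θ) := by
  unfold subSurfaceMeasure; infer_instance

instance : IsFiniteMeasure (surfaceMeasure n) := by
  unfold surfaceMeasure; infer_instance

theorem finrank_perpHyperplane (θ : Sph n) : Module.finrank ℝ (perpHyperplane θ) = n - 1 := by
  have h := (ℝ ∙ (θ : Euc n)).finrank_add_finrank_orthogonal
  rw [finrank_span_singleton, finrank_euclideanSpace_fin] at h
  · exact Nat.eq_sub_of_add_eq' h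
  · intro h0
    have := norm_eq_of_mem_sphere θ
    rw [h0, norm_zero] at this
    exact zero_ne_one this

/-- The hyperplane has dimension `n - 1`, giving the density `r^(n-2)`; the factor `r` in
`radialGaussian` raises it to `r^(n-1)`. This is the radial constant of
`integral_homogExt_mul_radialGaussian`, where that factor is cancelled by the degree `-1` extension
instead. -/
theorem integral_perpHyperplane_radialGaussian (hn : 2 ≤ n) (q : Sph n → ℝ) (θ : Sph n) :
    ∫ x : perpHyperplane θ, radialGaussian q x ∂perpLebesgue θ = sphericalRadon q θ *
      ∫ r in Set.Ioi (0 : ℝ), r ^ (n - 1) * Real.exp (-2 * r ^ 2) := by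
  have hfin := finrank_perpHyperplane θ
  have : Nontrivial (perpHyperplane θ) := Module.nontrivial_of_finrank_pos (R := ℝ) (by omega)
  rw [integral_eq_toSphere_mul_radial (perpLebesgue θ) (q := fun ξ => q (subSphIncl θ ξ))
    (w := fun r => r * Real.exp (-2 * r ^ 2))
    (fun ξ r hr => radialGaussian_smul q (subSphIncl θ ξ) hr), hfin]
  congr 2
  ext r
  rw [← mul_assoc, ← pow_succ, show n - 1 - 1 + 1 = n - 1 by omega]

theorem integral_homogExt_mul_radialGaussian (hn : 2 ≤ n) (h q : Sph n → ℝ) :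
    ∫ x, homogExt h x * radialGaussian q x = (∫ ξ, h ξ * q ξ ∂surfaceMeasure n) *
      ∫ r in Set.Ioi (0 : ℝ), r ^ (n - 1) * Real.exp (-2 * r ^ 2) := by
  have : Nontrivial (Euc n) :=
    Module.nontrivial_of_finrank_pos (R := ℝ) (by rw [finrank_euclideanSpace_fin]; omega)
  rw [integral_eq_toSphere_mul_radial volume (q := fun ξ => h ξ * q ξ)
    (w := fun r => Real.exp (-2 * r ^ 2)) (fun ξ r hr => ?_), finrank_euclideanSpace_fin]
  · rfl
  · rw [radialGaussian_smul q ξ hr, homogExt_smul h hr, homogExt_coe_sphere]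
    field_simp

/-- The Jacobian `r^n` of `x = r y` cancels the `r^(-n)` from the Fourier transform, leaving only
the degree `-1` of the homogeneous extension. -/
theorem apply_fourier_schwartzDilation {h : Sph n → ℝ} {T : 𝓢'(Euc n, ℂ)}
    (hT : Represents (homogExt h) T) {r : ℝ} (hr : 0 < r) (φ : 𝓢(Euc n, ℂ)) :
    T (𝓕 (schwartzDilation r hr.ne' φ)) = (r⁻¹ : ℝ) * T (𝓕 φ) := by
  rw [(hT.2 _).2, (hT.2 _).2]
  have hcv := Measure.integral_comp_smul (volume : Measure (Euc n))
    (fun y => (homogExt h (r • y) : ℂ) * 𝓕 φ y) r⁻¹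
  simp only [smul_smul, mul_inv_cancel₀ hr.ne', one_smul, finrank_euclideanSpace_fin] at hcv
  simp only [fourier_schwartzDilation hr, finrank_euclideanSpace_fin]
  have e1 : ∀ x : Euc n, (homogExt h x : ℂ) * ((((r ^ n)⁻¹ : ℝ) : ℂ) * 𝓕 φ (r⁻¹ • x))
      = (((r ^ n)⁻¹ : ℝ) : ℂ) * ((homogExt h x : ℂ) * 𝓕 φ (r⁻¹ • x)) := fun x => by ring
  have e2 : ∀ y : Euc n, (homogExt h (r • y) : ℂ) * 𝓕 φ y
      = ((r⁻¹ : ℝ) : ℂ) * ((homogExt h y : ℂ) * 𝓕 φ y) := fun y => by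
    rw [homogExt_smul h hr]; push_cast; ring
  simp only [e1, integral_const_mul]
  rw [hcv]
  simp only [e2, integral_const_mul]
  rw [Complex.real_smul, ← mul_assoc, ← Complex.ofReal_mul, inv_pow, inv_inv,
    abs_of_pos (by positivity), inv_mul_cancel₀ (by positivity), Complex.ofReal_one, one_mul]

/-- If the degree `-1` homogeneous extension of `h ≥ 0` is positive definite and the even function
`q` has nonnegative spherical Radon transform, then `∫ h q ≥ 0`. -/
theorem integral_mul_nonneg_of_sphericalRadon_nonneg (hn : 2 ≤ n) {h q : Sph n → ℝ}
    (hh : ∀ ξ, 0 ≤ h ξ) (hq : Continuous q) (hq_even : ∀ ξ, q (-ξ) = q ξ)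
    (hR : ∀ θ, 0 ≤ sphericalRadon q θ) (hpd : RepresentsPositiveDefinite (homogExt h)) :
    0 ≤ ∫ ξ, h ξ * q ξ ∂surfaceMeasure n := by
  obtain ⟨T, hT, hTpos⟩ := hpd
  have : Nontrivial (Euc n) :=
    Module.nontrivial_of_finrank_pos (R := ℝ) (by rw [finrank_euclideanSpace_fin]; omega)
  obtain ⟨C, hC0, hC⟩ := exists_abs_le_of_continuous hq
  let Λ : 𝓢(Euc n, ℂ) →ₗ[ℂ] ℂ :=
    { toFun := fun φ => 𝓕 T φ
      map_add' := fun φ ψ => map_add _ φ ψ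
      map_smul' := fun c φ => map_smul _ c φ }
  have hΛ : ∀ φ, Λ φ = T (𝓕 φ) := fun φ => TemperedDistribution.fourier_apply T φ
  have hdil : ∀ (r : ℝ) (hr : 0 < r) (φ : 𝓢(Euc n, ℂ)),
      Λ (schwartzDilation r hr.ne' φ) = (r⁻¹ : ℝ) * Λ φ := fun r hr φ => by
    rw [hΛ, hΛ, apply_fourier_schwartzDilation hT hr]
  have hu0 := homogExt_nonneg hh
  set u := homogExt h with hu
  have hum : AEStronglyMeasurable u := hT.1.aestronglyMeasurable
  have hue : Integrable fun x : Euc n => u x * Real.exp (-‖x‖ ^ 2) := by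
    have h1 := (hT.2 (gaussianSchwartz one_pos 0)).1.re
    refine h1.congr (.of_forall fun x => ?_)
    simp only [gaussianSchwartz_apply, sub_zero, neg_mul, one_mul]
    rw [← Complex.ofReal_mul]
    exact Complex.ofReal_re _
  have huQ : Integrable fun x : Euc n => u x * radialGaussian q x := by
    refine (hue.const_mul C).mono'
      (hum.mul (continuous_radialGaussian hq).aestronglyMeasurable) (.of_forall fun x => ?_)
    rw [norm_mul, Real.norm_of_nonneg (hu0 x), Real.norm_eq_abs]
    have h1 : |radialGaussian q x| ≤ C * Real.exp (-‖x‖ ^ 2) :=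
      (abs_radialGaussian_le_exp hC hC0 x).trans (by gcongr; nlinarith [sq_nonneg ‖x‖])
    nlinarith [mul_le_mul_of_nonneg_left h1 (hu0 x)]
  set J := ∫ x : Euc n, u x * Real.exp (-‖x‖ ^ 2) with hJ
  have hJ0 : 0 ≤ J := integral_nonneg fun x => mul_nonneg (hu0 x) (Real.exp_pos _).le
  set I := ∫ r in Set.Ioi (0 : ℝ), r ^ (n - 1) * Real.exp (-2 * r ^ 2) with hI
  have hI0 : 0 < I := integral_pow_mul_exp_neg_two_mul_sq_pos _
  have hgauss : ∀ θ : Sph n, Integrable (fun x : perpHyperplane θ => Real.exp (-‖(x : Euc n)‖ ^ 2))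
      (perpLebesgue θ) ∧ ∫ x : perpHyperplane θ, Real.exp (-‖(x : Euc n)‖ ^ 2) ∂perpLebesgue θ
        = Real.pi ^ ((n - 1) / 2 : ℝ) := by
    intro θ
    have h1 := integral_orthogonal_exp_neg_mul_norm_sub_sq one_pos (0 : Euc n)
      (norm_eq_of_mem_sphere θ)
    simp only [sub_zero, neg_mul, one_mul, inner_zero_left, div_one, finrank_euclideanSpace_fin,
      ne_eq, OfNat.ofNat_ne_zero, not_false_eq_true, zero_pow, mul_zero, Real.exp_zero,
      mul_one] at h1
    exact h1
  have key : ∀ η : ℝ, 0 < η → 0 ≤ (∫ x, u x * radialGaussian q x) + 3 * η * J := by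
    intro η hη
    obtain ⟨ψ₀, hψ₀, hnear⟩ := exists_mem_gaussianSpan_near_weighted
      (continuous_radialGaussian hq) (tendsto_exp_mul_radialGaussian hq) hη
    have hg : (fun x : Euc n => Real.exp (-1 * ‖x - 0‖ ^ 2)) ∈ gaussianSpan (Euc n) :=
      Submodule.subset_span ⟨1, one_pos, 0, rfl⟩
    -- The shift by `2η` makes the approximation one-sided: `ψ` exceeds `radialGaussian q` by
    -- between `η` and `3η` times `exp(-‖x‖²)`. The lower margin makes the ray integrals uniformly
    -- positive even where the Radon transform of `q` vanishes.
    set ψ : Euc n → ℝ := ψ₀ + (2 * η) • fun x : Euc n => Real.exp (-1 * ‖x - 0‖ ^ 2) with hψdef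
    have hψ : ψ ∈ gaussianSpan (Euc n) := Submodule.add_mem _ hψ₀ (Submodule.smul_mem _ _ hg)
    have hψval : ∀ x, ψ x = ψ₀ x + 2 * η * Real.exp (-‖x‖ ^ 2) := fun x => by simp [hψdef]
    have hlow : ∀ x, radialGaussian q x + η * Real.exp (-‖x‖ ^ 2) ≤ ψ x := fun x => by
      rw [hψval]; linarith [(abs_le.1 (hnear x)).1]
    have hup : ∀ x, ψ x ≤ radialGaussian q x + 3 * η * Real.exp (-‖x‖ ^ 2) := fun x => by
      rw [hψval]; linarith [(abs_le.1 (hnear x)).2]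
    obtain ⟨φ, hF, him, ⟨D, b, hb, hD⟩, hray⟩ :=
      exists_schwartz_fourier_eq_of_mem_gaussianSpan hψ
    have hpos : 0 ≤ (Λ φ).re := by
      refine re_nonneg_of_ray_integral_pos Λ hTpos hdil φ him hb
        (c := η * Real.pi ^ ((n - 1) / 2 : ℝ) / 2) (by positivity) hD fun θ hθ => ?_
      obtain ⟨hint, hval⟩ := hray θ hθ
      rw [hval]
      let θ' : Sph n := ⟨θ, mem_sphere_zero_iff_norm.2 hθ⟩
      obtain ⟨hgi, hgv⟩ := hgauss θ'
      have hQi : Integrable (fun x : perpHyperplane θ' => radialGaussian q x)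
          (perpLebesgue θ') := by
        refine (hgi.const_mul C).mono' ((continuous_radialGaussian hq).comp
          continuous_subtype_val).aestronglyMeasurable (.of_forall fun x => ?_)
        exact (abs_radialGaussian_le_exp hC hC0 x).trans
          (by gcongr; nlinarith [sq_nonneg ‖(x : Euc n)‖])
      have h1 : ∫ x : perpHyperplane θ', (radialGaussian q x + η * Real.exp (-‖(x : Euc n)‖ ^ 2))
          ∂perpLebesgue θ' ≤ ∫ x : perpHyperplane θ', ψ x ∂perpLebesgue θ' :=
        integral_mono (hQi.add (hgi.const_mul η)) hint fun x => hlow x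
      rw [integral_add hQi (hgi.const_mul η), integral_const_mul, hgv,
        integral_perpHyperplane_radialGaussian hn] at h1
      have h2 : 0 ≤ sphericalRadon q θ' * I := mul_nonneg (hR θ') hI0.le
      have h3 : η * Real.pi ^ ((n - 1) / 2 : ℝ)
        ≤ ∫ x : perpHyperplane θ', ψ x ∂perpLebesgue θ' := by linarith
      have h4 := div_le_div_of_nonneg_right h3 zero_le_two
      exact h4
    have hFu : ∀ x, (u x : ℂ) * 𝓕 φ x = ((u x * ((ψ x + ψ (-x)) / 2) : ℝ) : ℂ) := fun x => by
      rw [hF]; push_cast; ring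
    have hint : Integrable fun x : Euc n => u x * ((ψ x + ψ (-x)) / 2) := by
      refine (hT.2 (𝓕 φ)).1.re.congr (.of_forall fun x => ?_)
      simp only [hFu]
      exact Complex.ofReal_re _
    rw [hΛ, (hT.2 (𝓕 φ)).2] at hpos
    simp only [hFu] at hpos
    rw [integral_complex_ofReal, Complex.ofReal_re] at hpos
    refine hpos.trans ?_
    rw [hJ, ← integral_const_mul, ← integral_add huQ (hue.const_mul _)]
    refine integral_mono hint (huQ.add (hue.const_mul _)) fun x => ?_
    -- Evenness of `q` enters here: the upper bound for `ψ` passes to its even part, the only part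
    -- seen by `𝓕 φ`.
    have hQneg : radialGaussian q (-x) = radialGaussian q x := by
      unfold radialGaussian
      rw [norm_neg, homogExt_neg hq_even]
    have h1 := hup x
    have h2 := hup (-x)
    rw [norm_neg, hQneg] at h2
    have h3 : (ψ x + ψ (-x)) / 2 ≤ radialGaussian q x + 3 * η * Real.exp (-‖x‖ ^ 2) := by linarith
    have h4 := mul_le_mul_of_nonneg_left h3 (hu0 x)
    linarith
  have hQnn : 0 ≤ ∫ x, u x * radialGaussian q x := by
    -- The choice of `η` makes the error `3 η J` at most `ε`; `J + 1` avoids dividing by zero.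
    refine le_of_forall_pos_le_add fun ε hε => (key (ε / (3 * (J + 1))) (by positivity)).trans ?_
    gcongr
    calc 3 * (ε / (3 * (J + 1))) * J = ε * (J / (J + 1)) := by field_simp
      _ ≤ ε * 1 := by gcongr; rw [div_le_one (by positivity)]; linarith
      _ = ε := mul_one _
  rw [hu, integral_homogExt_mul_radialGaussian hn] at hQnn
  exact nonneg_of_mul_nonneg_left hQnn hI0

end HomogeneousExtension

/-! ### Hölder's inequality for both ranges of `p` -/

section Hoelder

variable {X : Type*} [TopologicalSpace X] [CompactSpace X] [MeasurableSpace X]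
  [OpensMeasurableSpace X] {μ : Measure X} [IsFiniteMeasure μ]

theorem memLp_of_continuous_of_compactSpace {f : X → ℝ} (hf : Continuous f) (p : ENNReal) :
    MemLp f p μ := by
  obtain ⟨C, hC⟩ := isCompact_univ.exists_bound_of_continuousOn hf.continuousOn
  exact MemLp.of_bound (hf.aestronglyMeasurable_of_compactSpace) C
    (.of_forall fun x => hC x trivial)

theorem eLpNorm_le_of_integral_rpow_le {f g : X → ℝ} (hf : Continuous f) (hg : Continuous g)
    (hf0 : ∀ x, 0 < f x) (hg0 : ∀ x, 0 < g x) {p : ℝ} (hp : 0 < p)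
    (h : ∫ x, f x ^ p ∂μ ≤ ∫ x, g x ^ p ∂μ) :
    eLpNorm f (ENNReal.ofReal p) μ ≤ eLpNorm g (ENNReal.ofReal p) μ := by
  have hp0 : ENNReal.ofReal p ≠ 0 := by simpa using hp
  rw [(memLp_of_continuous_of_compactSpace hf _).eLpNorm_eq_integral_rpow_norm hp0
      ENNReal.ofReal_ne_top,
    (memLp_of_continuous_of_compactSpace hg _).eLpNorm_eq_integral_rpow_norm hp0
      ENNReal.ofReal_ne_top, ENNReal.toReal_ofReal hp.le]
  simp only [Real.norm_of_nonneg (hf0 _).le, Real.norm_of_nonneg (hg0 _).le]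
  apply ENNReal.ofReal_le_ofReal
  exact Real.rpow_le_rpow (integral_nonneg fun x => Real.rpow_nonneg (hf0 x).le _) h (by positivity)

/-- Hölder bounds `∫ g f^(p-1)` by `‖g‖_p ‖f‖_p^(p-1)`; the second factor cancels unless `∫ f^p =
0`, when the claim is trivial. -/
theorem integral_rpow_le_of_one_lt {f g : X → ℝ} (hf : Continuous f) (hg : Continuous g)
    (hf0 : ∀ x, 0 < f x) (hg0 : ∀ x, 0 < g x) {p : ℝ} (hp : 1 < p)
    (h : ∫ x, f x ^ p ∂μ ≤ ∫ x, g x * f x ^ (p - 1) ∂μ) :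
    ∫ x, f x ^ p ∂μ ≤ ∫ x, g x ^ p ∂μ := by
  have hp0 : 0 < p := by linarith
  have hp1 : 0 < p - 1 := by linarith
  have hconj : p.HolderConjugate (p / (p - 1)) := Real.HolderConjugate.conjExponent hp
  have hfc : Continuous fun x => f x ^ (p - 1) :=
    hf.rpow_const fun x => Or.inl (hf0 x).ne'
  have hH := integral_mul_le_Lp_mul_Lq_of_nonneg (μ := μ) hconj
    (.of_forall fun x => (hg0 x).le) (.of_forall fun x => Real.rpow_nonneg (hf0 x).le (p - 1))
    (memLp_of_continuous_of_compactSpace hg _) (memLp_of_continuous_of_compactSpace hfc _)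
  have e : ∀ x, (f x ^ (p - 1)) ^ (p / (p - 1)) = f x ^ p := fun x => by
    rw [← Real.rpow_mul (hf0 x).le, mul_div_cancel₀ _ hp1.ne']
  simp only [e] at hH
  set A := ∫ x, f x ^ p ∂μ
  set B := ∫ x, g x ^ p ∂μ
  have hA0 : 0 ≤ A := integral_nonneg fun x => Real.rpow_nonneg (hf0 x).le _
  have hB0 : 0 ≤ B := integral_nonneg fun x => Real.rpow_nonneg (hg0 x).le _
  rcases hA0.eq_or_lt with hA | hA
  · rw [← hA]; exact hB0
  · have h1 : A ≤ B ^ (1 / p) * A ^ (1 / (p / (p - 1))) := h.trans hH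
    have h2 : A = A ^ (1 / p) * A ^ (1 / (p / (p - 1))) := by
      rw [← Real.rpow_add hA]
      rw [show 1 / p + 1 / (p / (p - 1)) = 1 by field_simp; ring, Real.rpow_one]
    have h3 : A ^ (1 / p) ≤ B ^ (1 / p) := by
      refine le_of_mul_le_mul_right ?_ (Real.rpow_pos_of_pos hA (1 / (p / (p - 1))))
      rwa [← h2]
    exact (Real.rpow_le_rpow_iff hA0 hB0 (by positivity)).1 h3

/-- Write `f^p = (f g^(p-1))^p · g^(p(1-p))` and apply Hölder with exponents `1/p` and `1/(1-p)`;
the hypothesis bounds the first factor by `(∫ g^p)^p`. -/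
theorem integral_rpow_le_of_lt_one {f g : X → ℝ} (hf : Continuous f) (hg : Continuous g)
    (hf0 : ∀ x, 0 < f x) (hg0 : ∀ x, 0 < g x) {p : ℝ} (hp0 : 0 < p) (hp : p < 1)
    (h : ∫ x, f x * g x ^ (p - 1) ∂μ ≤ ∫ x, g x ^ p ∂μ) :
    ∫ x, f x ^ p ∂μ ≤ ∫ x, g x ^ p ∂μ := by
  have hp1 : 0 < 1 - p := by linarith
  have hconj : (1 / p).HolderConjugate (1 / (1 - p)) := by
    rw [Real.holderConjugate_iff]
    refine ⟨by rw [lt_div_iff₀ hp0]; linarith, ?_⟩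
    simp
  have hgc : ∀ s : ℝ, Continuous fun x => g x ^ s := fun s =>
    hg.rpow_const fun x => Or.inl (hg0 x).ne'
  have hac : Continuous fun x => (f x * g x ^ (p - 1)) ^ p :=
    (hf.mul (hgc _)).rpow_const fun x =>
      Or.inl (mul_pos (hf0 x) (Real.rpow_pos_of_pos (hg0 x) _)).ne'
  have hfg0 : ∀ x, 0 < f x * g x ^ (p - 1) := fun x =>
    mul_pos (hf0 x) (Real.rpow_pos_of_pos (hg0 x) _)
  have hH := integral_mul_le_Lp_mul_Lq_of_nonneg (μ := μ) hconj
    (.of_forall fun x => Real.rpow_nonneg (hfg0 x).le p)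
    (.of_forall fun x => Real.rpow_nonneg (hg0 x).le (p * (1 - p)))
    (memLp_of_continuous_of_compactSpace hac _)
    (memLp_of_continuous_of_compactSpace (hgc (p * (1 - p))) _)
  have e1 : ∀ x, (f x * g x ^ (p - 1)) ^ p * g x ^ (p * (1 - p)) = f x ^ p := fun x => by
    rw [Real.mul_rpow (hf0 x).le (Real.rpow_nonneg (hg0 x).le _), ← Real.rpow_mul (hg0 x).le,
      mul_assoc, ← Real.rpow_add (hg0 x), show (p - 1) * p + p * (1 - p) = 0 by ring,
      Real.rpow_zero, mul_one]
  have e2 : ∀ x, ((f x * g x ^ (p - 1)) ^ p) ^ (1 / p) = f x * g x ^ (p - 1) := fun x => by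
    rw [← Real.rpow_mul (hfg0 x).le, mul_one_div_cancel hp0.ne', Real.rpow_one]
  have e3 : ∀ x, (g x ^ (p * (1 - p))) ^ (1 / (1 - p)) = g x ^ p := fun x => by
    rw [← Real.rpow_mul (hg0 x).le, mul_assoc, mul_one_div_cancel hp1.ne', mul_one]
  simp only [e1, e2, e3, one_div_one_div] at hH
  set B := ∫ x, g x ^ p ∂μ
  have hB0 : 0 ≤ B := integral_nonneg fun x => Real.rpow_nonneg (hg0 x).le _
  calc ∫ x, f x ^ p ∂μ ≤ (∫ x, f x * g x ^ (p - 1) ∂μ) ^ p * B ^ (1 - p) := hH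
    _ ≤ B ^ p * B ^ (1 - p) := by
        gcongr
        exact integral_nonneg fun x => (hfg0 x).le
    _ = B := by
        rw [← Real.rpow_add_of_nonneg hB0 hp0.le hp1.le, add_sub_cancel, Real.rpow_one]

end Hoelder

/-! ### Comparison of the `L^p` norms -/

theorem sphericalRadon_sub_nonneg {n : ℕ} {f g : Sph n → ℝ} (hf : Continuous f) (hg : Continuous g)
    (hR : ∀ θ, sphericalRadon f θ ≤ sphericalRadon g θ) (θ : Sph n) :
    0 ≤ sphericalRadon (fun ξ => g ξ - f ξ) θ := by
  have hint : ∀ {k : Sph n → ℝ}, Continuous k →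
      Integrable (fun ξ => k (subSphIncl θ ξ)) (subSurfaceMeasure θ) := fun hk =>
    memLp_one_iff_integrable.1
      (memLp_of_continuous_of_compactSpace (hk.comp (continuous_subSphIncl θ)) 1)
  unfold sphericalRadon
  rw [integral_sub (hint hg) (hint hf)]
  exact sub_nonneg.2 (hR θ)

theorem theoremt (n : ℕ) (hn : 2 ≤ n) (f g : Sph n → ℝ)
    (hf : Continuous f) (hg : Continuous g)
    (hf_even : ∀ x, f (-x) = f x) (hg_even : ∀ x, g (-x) = g x)
    (hf_pos : ∀ x, 0 < f x) (hg_pos : ∀ x, 0 < g x)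
    (hR : ∀ θ, sphericalRadon f θ ≤ sphericalRadon g θ) :
    (∀ p : ℝ, 1 < p →
      RepresentsPositiveDefinite (homogExt fun ξ => f ξ ^ (p - 1)) →
      eLpNorm f (ENNReal.ofReal p) (surfaceMeasure n)
        ≤ eLpNorm g (ENNReal.ofReal p) (surfaceMeasure n)) ∧
    (∀ p : ℝ, 0 < p → p < 1 →
      RepresentsPositiveDefinite (homogExt fun ξ => g ξ ^ (p - 1)) →
      eLpNorm f (ENNReal.ofReal p) (surfaceMeasure n)
        ≤ eLpNorm g (ENNReal.ofReal p) (surfaceMeasure n)) := by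
  have hint : ∀ {k : Sph n → ℝ}, Continuous k → Integrable k (surfaceMeasure n) := fun hk =>
    memLp_one_iff_integrable.1 (memLp_of_continuous_of_compactSpace hk 1)
  -- The duality inequality for `q = g - f`. Only the choice of the weight `h` differs between the
  -- two ranges of `p`: a power of `f` for `p > 1`, of `g` for `p < 1`.
  have hdiff : ∀ (h : Sph n → ℝ), Continuous h → (∀ ξ, 0 < h ξ) →
      RepresentsPositiveDefinite (homogExt h) →
      ∫ ξ, f ξ * h ξ ∂surfaceMeasure n ≤ ∫ ξ, g ξ * h ξ ∂surfaceMeasure n := by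
    intro h hc h0 hpd
    have key := integral_mul_nonneg_of_sphericalRadon_nonneg hn (fun ξ => (h0 ξ).le) (hg.sub hf)
      (fun ξ => by rw [Pi.sub_apply, Pi.sub_apply, hf_even, hg_even])
      (sphericalRadon_sub_nonneg hf hg hR) hpd
    have e : ∀ ξ, h ξ * (g - f) ξ = g ξ * h ξ - f ξ * h ξ := fun ξ => by
      rw [Pi.sub_apply]; ring
    simp only [e] at key
    have hsub : ∫ ξ, (g ξ * h ξ - f ξ * h ξ) ∂surfaceMeasure n
        = (∫ ξ, g ξ * h ξ ∂surfaceMeasure n) - ∫ ξ, f ξ * h ξ ∂surfaceMeasure n :=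
      integral_sub (hint (hg.mul hc)) (hint (hf.mul hc))
    rw [hsub] at key
    linarith
  have hpow : ∀ {k : Sph n → ℝ}, (∀ ξ, 0 < k ξ) → ∀ (p : ℝ) (ξ : Sph n),
      k ξ * k ξ ^ (p - 1) = k ξ ^ p := fun hk p ξ => by
    rw [Real.rpow_sub_one (hk ξ).ne', mul_div_cancel₀ _ (hk ξ).ne']
  refine ⟨fun p hp hpd => ?_, fun p hp0 hp hpd => ?_⟩
  · have h := hdiff _ (hf.rpow_const fun ξ => Or.inl (hf_pos ξ).ne')
      (fun ξ => Real.rpow_pos_of_pos (hf_pos ξ) _) hpd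
    simp only [hpow hf_pos] at h
    exact eLpNorm_le_of_integral_rpow_le hf hg hf_pos hg_pos (by linarith)
      (integral_rpow_le_of_one_lt hf hg hf_pos hg_pos hp h)
  · have h := hdiff _ (hg.rpow_const fun ξ => Or.inl (hg_pos ξ).ne')
      (fun ξ => Real.rpow_pos_of_pos (hg_pos ξ) _) hpd
    simp only [hpow hg_pos] at h
    exact eLpNorm_le_of_integral_rpow_le hf hg hf_pos hg_pos hp0
      (integral_rpow_le_of_lt_one hf hg hf_pos hg_pos hp0 hp h)
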